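/- For complex $b_1,\dots,b_4$ and $x>0$ let $$G_{04}^{20}(x\mid b_1,b_2,b_3,b_4)=\frac{1}{2\pi\sqrt{-1}}\int_L\frac{\Gamma(b_1-\lambda)\Gamma(b_2-\lambda)}{\Gamma(1-b_3+\lambda)\Gamma(1-b_4+\lambda)}\,x^{\lambda}\,d\lambda$$ be Meijer's $G$-function, where the contour $L$ runs from $c-\sqrt{-1}\infty$ to $c+\sqrt{-1}\infty$ for some real $c>\frac14(\operatorname{Re}(b_1+b_2+b_3+b_4)-1)$ and leaves all the points $b_j, b_j+1, b_j+2,\dots$ ($j=1,2$) to its right. Let $b_1,b_2,\gamma\in\frac12\mathbb{Z}$ satisfy $b_1\ge 0$, $\gamma\ge 1$ and $\frac{1-\gamma}{2}\le b_2\le \frac12+b_1$. Then there is a unique unitary operator $S=S_{b_1,b_2,\gamma}$ on $L^2(\mathbb{R}_+)$ (complex-valued functions, Lebesgue measure) given for all $f\in L^2(\mathbb{R}_+)$ by $$(Sf)(x)=\frac1\gamma\int_0^\infty G_{04}^{20}\bigl((xy)^{\frac1\gamma}\mid b_1,b_2,1-\gamma-b_1,1-\gamma-b_2\bigr)f(y)\,dy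 ,$$ and $S$ is of order two, that is, $S\neq\mathrm{id}$ and $S^{-1}=S$. Consequently the reciprocal formula $$f(x)=\frac1\gamma\int_0^\infty G_{04}^{20}\bigl((xy)^{\frac1\gamma}\mid b_1,b_2,1-\gamma-b_1,1-\gamma-b_2\bigr)(Sf)(y)\,dy$$ holds for all $f\in L^2(\mathbb{R}_+)$. Here, for $f\in L^2(\mathbb{R}_+)$, the integral $\int_0^\infty$ is understood as the limit in $L^2(\mathbb{R}_+)$, as $R\to\infty$, of the integrals $\int_0^R$, which converge absolutely for every $x>0$ and define functions in $L^2(\mathbb{R}_+)$; for almost every $x>0$, if the integral over $(0,\infty)$ converges absolutely at $x$, the formula holds literally at $x$. -/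

import Mathlib

open MeasureTheory Set Filter Topology

noncomputable section

/-- The integrand `Γ(b₁-λ)Γ(b₂-λ) / (Γ(1-b₃+λ)Γ(1-b₄+λ)) x^λ` of the Mellin–Barnes integral
of `G^{20}_{04}`. (Where a factor of the denominator has a pole, Mathlib's `Complex.Gamma`
is `0`, so that the quotient is `0`, which is the correct value of the reciprocal Gamma function.) -/
def meijerIntegrand (b₁ b₂ b₃ b₄ : ℂ) (x : ℝ) (l : ℂ) : ℂ :=
  Complex.Gamma (b₁ - l) * Complex.Gamma (b₂ - l) /
    (Complex.Gamma (1 - b₃ + l) * Complex.Gamma (1 - b₄ + l)) * (x : ℂ) ^ l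

/-- Abscissa at which the contour crosses the strip containing the poles `b_j, b_j+1, …`
(`j = 1, 2`); all of them lie to the right of it. -/
def contourCross (b₁ b₂ : ℂ) : ℝ := min b₁.re b₂.re - 1 / 8

/-- Abscissa of the two ends of the contour; it exceeds `(Re(b₁+b₂+b₃+b₄) - 1) / 4`,
which is the condition for convergence of the Mellin–Barnes integral. -/
def contourEnd (b₁ b₂ b₃ b₄ : ℂ) : ℝ :=
  max (contourCross b₁ b₂) (((b₁ + b₂ + b₃ + b₄).re - 1) / 4 + 1 / 8)

/-- A height such that all the poles `b_j + n` satisfy `|Im (b_j + n)| < T`. -/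
def contourHeight (b₁ b₂ : ℂ) : ℝ := 1 + |b₁.im| + |b₂.im|

/-- Meijer's `G`-function `G^{20}_{04}(x | b₁, b₂, b₃, b₄)`, `x > 0`, as
`(1 / 2πi) ∫_L` of `meijerIntegrand`, where `L` is the polygonal contour
`c - i∞ → c - iT → s - iT → s + iT → c + iT → c + i∞`
with `c = contourEnd`, `s = contourCross`, `T = contourHeight`; it leaves the poles
`b_j, b_j+1, …` (`j = 1, 2`) to the right. -/
def meijerG2004 (x : ℝ) (b₁ b₂ b₃ b₄ : ℂ) : ℂ :=
  let F := meijerIntegrand b₁ b₂ b₃ b₄ x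
  let c := contourEnd b₁ b₂ b₃ b₄
  let s := contourCross b₁ b₂
  let T := contourHeight b₁ b₂
  1 / (2 * Real.pi * Complex.I) *
    (Complex.I * (∫ t in Iic (-T), F (c + t * Complex.I))
      + (∫ u in c..s, F (u - T * Complex.I))
      + Complex.I * (∫ t in (-T)..T, F (s + t * Complex.I))
      + (∫ u in s..c, F (u + T * Complex.I))
      + Complex.I * (∫ t in Ioi T, F (c + t * Complex.I)))

/-- The function `G^{20}_{04}((xy)^{1/γ} | b₁, b₂, 1-γ-b₁, 1-γ-b₂)`. -/
def gKernel (b₁ b₂ γ x y : ℝ) : ℂ :=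
  meijerG2004 ((x * y) ^ (1 / γ)) b₁ b₂ (1 - γ - b₁) (1 - γ - b₂)

/-- The Hilbert space `L²(ℝ₊)` (complex valued, Lebesgue measure). -/
abbrev L2Pos : Type := Lp ℂ 2 (volume.restrict (Ioi (0 : ℝ)))

/-- The truncated transform
`x ↦ (1/γ) ∫_0^R G^{20}_{04}((xy)^{1/γ} | b₁, b₂, 1-γ-b₁, 1-γ-b₂) f(y) dy`. -/
def gTransformTrunc (b₁ b₂ γ R : ℝ) (f : ℝ → ℂ) (x : ℝ) : ℂ :=
  1 / (γ : ℂ) * ∫ y in Ioc 0 R, gKernel b₁ b₂ γ x y * f y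

/-- `g(x) = (1/γ) ∫_0^∞ G^{20}_{04}((xy)^{1/γ} | b₁, b₂, 1-γ-b₁, 1-γ-b₂) f(y) dy`
in the `L²`-sense: for `f ∈ L²(ℝ₊)` the integral over `(0,∞)` need not converge absolutely, and is
the limit in `L²(ℝ₊)` of the absolutely convergent integrals over `(0,R]` as `R → ∞`. Where the
integral over `(0,∞)` does converge absolutely, the formula holds literally. -/
structure IsGTransform (b₁ b₂ γ : ℝ) (f g : L2Pos) : Prop where
  integrableOn : ∀ R > 0, ∀ x > 0,
    IntegrableOn (fun y => gKernel b₁ b₂ γ x y * f y) (Ioc 0 R)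
  memLp : ∀ R > 0, MemLp (gTransformTrunc b₁ b₂ γ R f) 2 (volume.restrict (Ioi (0 : ℝ)))
  tendsto : Tendsto
    (fun R : ℝ => eLpNorm (gTransformTrunc b₁ b₂ γ R f - (g : ℝ → ℂ)) 2
      (volume.restrict (Ioi (0 : ℝ)))) atTop (𝓝 0)
  eq_integral : ∀ᵐ x ∂(volume.restrict (Ioi (0 : ℝ))),
    IntegrableOn (fun y => gKernel b₁ b₂ γ x y * f y) (Ioi 0) →
      g x = 1 / (γ : ℂ) * ∫ y in Ioi 0, gKernel b₁ b₂ γ x y * f y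

end

/-! Put `λ = γ(z - 1/2)` in the Mellin–Barnes integral. Then `(1/γ) G((xy)^{1/γ})` becomes `κ(xy)`
with `κ(u) = u^{-1/2} k(log u)`, where `k` is the inverse Laplace transform, along a line `Re z = δ
> 0`, of the symbol `m(z) = ∏ Γ(b_j - λ) / Γ(γ + b_j + λ)`. On `Re z = 0` the arguments of numerator
and denominator are complex conjugates, so `|m| = 1`. In the coordinates `x = e^v`, with `f(x)`
replaced by `e^{v/2} f(e^v)`, the transform has kernel `k(v + u)`. It is Fourier transform,
multiplication by a unimodular function, Fourier transform again, hence isometric by Plancherel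
(`eLpNorm_lineKernel_integral`).

The inverse transform of `m` does not converge absolutely on `Re z = 0`. The Gauss product gives
`|m(x + it)| = O(|t|^{-4γx})` (`norm_Gamma_le`, `norm_gSymbol_le`), which is integrable on `Re z =
δ`. For test functions Cauchy's theorem moves the line from `δ` to `0`, the Laplace transform of the
test function supplying the decay (`lineKernel_integral_eq_fourier`).

Since `κ` is real and `κ(xy)` is symmetric, the isometric extension `S` to `L²` is self-adjoint;
hence `S² = S*S = 1`, which is the reciprocal formula (`extendedOp_extendedOp`). The bound `|κ(u)| ≤
C u^a` with `a > -1/2` makes the truncated integrals converge absolutely, and `coeFn_extendedOp`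
identifies them with the values of `S` on truncated functions. Finally, `S = 1` is incompatible with
dilations (`unitaryOp_ne_one`). -/

noncomputable section

open scoped FourierTransform ContDiff ComplexConjugate

/-! ### Growth of the Gamma function along horizontal lines -/

/-- One factor of the Gauss product for a ratio of Gamma functions. -/
theorem log_norm_ratio_le (y d t : ℝ) (hy : 0 ≤ y) (hd : 0 ≤ d) (ht : 1 ≤ |t|) :
    Real.log ((y + d) ^ 2 + t ^ 2) - Real.log (y ^ 2 + t ^ 2) ≤
      d * (Real.log ((y + 1) ^ 2 + t ^ 2) - Real.log (y ^ 2 + t ^ 2)) +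
        2 * d * (d + 1) * (1 / (y ^ 2 + 1)) := by
  have ht2 : 1 ≤ t ^ 2 := by
    rw [← sq_abs]; nlinarith
  have hder : ∀ x : ℝ, HasDerivAt (fun x : ℝ => Real.log (x ^ 2 + t ^ 2))
      (2 * x / (x ^ 2 + t ^ 2)) x := by
    intro x
    have h1 : HasDerivAt (fun x : ℝ => x ^ 2 + t ^ 2) (2 * x) x := by
      simpa using (hasDerivAt_pow 2 x).add_const (t ^ 2)
    exact h1.log (by positivity)
  have hmvt : ∀ e : ℝ, 0 < e → ∃ ξ ∈ Ioo y (y + e),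
      Real.log ((y + e) ^ 2 + t ^ 2) - Real.log (y ^ 2 + t ^ 2) =
        e * (2 * ξ / (ξ ^ 2 + t ^ 2)) := by
    intro e he
    obtain ⟨ξ, hξ, h⟩ := exists_hasDerivAt_eq_slope (fun x : ℝ => Real.log (x ^ 2 + t ^ 2))
      (fun x => 2 * x / (x ^ 2 + t ^ 2)) (show y < y + e by linarith)
      (fun x _ => (hder x).continuousAt.continuousWithinAt) (fun x _ => hder x)
    refine ⟨ξ, hξ, ?_⟩
    rw [h, add_sub_cancel_left, mul_div_cancel₀ _ he.ne']
  rcases hd.eq_or_lt with rfl | hd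
  · simp
  obtain ⟨ξ, hξ, h1⟩ := hmvt d hd
  obtain ⟨η, hη, h2⟩ := hmvt 1 one_pos
  rw [h1, h2]
  -- A step of length `d` is compared with `d` steps of length one because the latter telescope over
  -- the Gauss product. The error is the difference of the two mean-value slopes, which must be
  -- summable in `y` uniformly in `t`.
  have key : 2 * ξ / (ξ ^ 2 + t ^ 2) - 2 * η / (η ^ 2 + t ^ 2) ≤
      2 * (d + 1) * (1 / (y ^ 2 + 1)) := by
    have hξ0 : 0 < ξ := lt_of_le_of_lt hy hξ.1
    have hη0 : 0 < η := lt_of_le_of_lt hy hη.1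
    have e1 : 2 * ξ / (ξ ^ 2 + t ^ 2) - 2 * η / (η ^ 2 + t ^ 2) =
        2 * (ξ - η) * ((t ^ 2 - ξ * η) / ((ξ ^ 2 + t ^ 2) * (η ^ 2 + t ^ 2))) := by
      field_simp
      ring
    have e2 : |(t ^ 2 - ξ * η) / ((ξ ^ 2 + t ^ 2) * (η ^ 2 + t ^ 2))| ≤ 1 / (y ^ 2 + 1) := by
      rw [abs_div, abs_of_pos (show 0 < (ξ ^ 2 + t ^ 2) * (η ^ 2 + t ^ 2) by positivity),
        div_le_div_iff₀ (by positivity) (by positivity)]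
      have hle : y ^ 2 + 1 ≤ y ^ 2 + t ^ 2 := by linarith
      -- From `y² ≤ ξη` the left side is at most `(t² + ξη)²`; then Cauchy–Schwarz.
      have hcs : |t ^ 2 - ξ * η| * (y ^ 2 + t ^ 2) ≤ (ξ ^ 2 + t ^ 2) * (η ^ 2 + t ^ 2) := by
        have a1 : y * y ≤ ξ * η := mul_le_mul hξ.1.le hη.1.le hy hξ0.le
        have a2 : |t ^ 2 - ξ * η| ≤ t ^ 2 + ξ * η := by
          rw [abs_le]; constructor <;> nlinarith [mul_pos hξ0 hη0]
        calc _ ≤ (t ^ 2 + ξ * η) * (ξ * η + t ^ 2) := by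
              apply mul_le_mul a2 (by nlinarith) (by positivity)
              positivity
          _ ≤ _ := by nlinarith [mul_nonneg (sq_nonneg t) (sq_nonneg (ξ - η))]
      calc _ ≤ |t ^ 2 - ξ * η| * (y ^ 2 + t ^ 2) := by gcongr
        _ ≤ _ := by linarith
    have e3 : |2 * (ξ - η)| ≤ 2 * (d + 1) := by
      rw [abs_le]; constructor <;> linarith [hξ.1, hξ.2, hη.1, hη.2]
    rw [e1]
    calc _ ≤ |2 * (ξ - η) * ((t ^ 2 - ξ * η) / ((ξ ^ 2 + t ^ 2) * (η ^ 2 + t ^ 2)))| :=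
          le_abs_self _
      _ ≤ _ := by rw [abs_mul]; gcongr
  nlinarith [mul_le_mul_of_nonneg_left key hd.le]

theorem summable_one_div_sq_add_one : Summable (fun j : ℕ => 1 / ((j : ℝ) ^ 2 + 1)) := by
  refine Summable.of_nonneg_of_le (fun j => by positivity) (fun j => ?_)
    ((summable_nat_add_iff 1).2 (Real.summable_one_div_nat_pow.2 one_lt_two) |>.mul_left 2)
  rw [mul_one_div, div_le_div_iff₀ (by positivity) (by positivity)]
  push_cast
  nlinarith [sq_nonneg ((j : ℝ) - 1)]

/-- The constant in the comparison of Gamma functions on a horizontal line. -/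
def gammaRatioConst (d : ℝ) : ℝ :=
  Real.exp (d * (d + 1) * ∑' j : ℕ, 1 / ((j : ℝ) ^ 2 + 1))

theorem norm_add_mul_I (x t : ℝ) : ‖(x : ℂ) + t * Complex.I‖ = √(x ^ 2 + t ^ 2) :=
  Complex.norm_add_mul_I x t

/-- In logarithms the unit increments telescope to the power `d` of the ratio, and the errors are
dominated by the convergent series in `gammaRatioConst`. That constant depends neither on `t` nor on
`n`, which allows passage to the limit in the Gauss product. -/
theorem prod_norm_ratio_le (p d t : ℝ) (hp : 0 < p) (hd : 0 ≤ d) (ht : 1 ≤ |t|) (n : ℕ) :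
    ∏ j ∈ Finset.range n, ‖((p + d + j : ℝ) : ℂ) + t * Complex.I‖ ≤
      gammaRatioConst d * (‖((p + n : ℝ) : ℂ) + t * Complex.I‖ / ‖(p : ℂ) + t * Complex.I‖) ^ d *
      ∏ j ∈ Finset.range n, ‖((p + j : ℝ) : ℂ) + t * Complex.I‖ := by
  have ht0 : 0 < t ^ 2 := by
    have : 0 < |t| := by linarith
    have := abs_pos.1 this
    positivity
  have hpos : ∀ x : ℝ, 0 < x ^ 2 + t ^ 2 := fun x => by positivity
  simp only [norm_add_mul_I]
  have hs := fun x => Real.sqrt_pos.2 (hpos x)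
  rw [← Real.log_le_log_iff (Finset.prod_pos fun j _ => hs _) (by
      have := Finset.prod_pos (s := Finset.range n) fun j _ => hs (p + j)
      have := hs p
      have := hs (p + n)
      have : 0 < gammaRatioConst d := Real.exp_pos _
      positivity)]
  rw [Real.log_mul, Real.log_mul, Real.log_rpow, Real.log_div, Real.log_prod, Real.log_prod,
    gammaRatioConst, Real.log_exp]
  rotate_left
  · exact fun j _ => (hs _).ne'
  · exact fun j _ => (hs _).ne'
  · exact (hs _).ne'
  · exact (hs _).ne'
  · exact div_pos (hs _) (hs _)
  · exact (Real.exp_pos _).ne'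
  · exact (Real.rpow_pos_of_pos (div_pos (hs _) (hs _)) _).ne'
  · exact mul_ne_zero (Real.exp_pos _).ne' (Real.rpow_pos_of_pos (div_pos (hs _) (hs _)) _).ne'
  · exact (Finset.prod_pos fun j _ => hs _).ne'
  simp only [Real.log_sqrt (hpos _).le]
  have h1 : ∑ j ∈ Finset.range n, (Real.log ((p + j + d) ^ 2 + t ^ 2) -
      Real.log ((p + j) ^ 2 + t ^ 2)) ≤
      ∑ j ∈ Finset.range n, (d * (Real.log ((p + (j + 1 : ℕ)) ^ 2 + t ^ 2) -
        Real.log ((p + j) ^ 2 + t ^ 2)) + 2 * d * (d + 1) * (1 / ((j : ℝ) ^ 2 + 1))) := by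
    refine Finset.sum_le_sum fun j _ => ?_
    refine (log_norm_ratio_le (p + j) d t (by positivity) hd ht).trans ?_
    push_cast
    rw [add_assoc p]
    gcongr
    linarith
  rw [Finset.sum_add_distrib, ← Finset.mul_sum, ← Finset.mul_sum,
    Finset.sum_range_sub (fun j : ℕ => Real.log ((p + j) ^ 2 + t ^ 2))] at h1
  have h2 : ∑ j ∈ Finset.range n, 1 / ((j : ℝ) ^ 2 + 1) ≤ ∑' j : ℕ, 1 / ((j : ℝ) ^ 2 + 1) :=
    summable_one_div_sq_add_one.sum_le_tsum _ (fun j _ => by positivity)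
  have h3 : d * (d + 1) * ∑ j ∈ Finset.range n, 1 / ((j : ℝ) ^ 2 + 1) ≤
      d * (d + 1) * ∑' j : ℕ, 1 / ((j : ℝ) ^ 2 + 1) := by gcongr
  rw [Finset.sum_sub_distrib] at h1
  have h4 : ∀ j : ℕ, p + d + (j : ℝ) = p + j + d := fun j => by ring
  simp only [h4, ← Finset.sum_div]
  simp only [Nat.cast_zero, add_zero] at h1
  linarith

/-- A sharp comparison of the Gamma function at two points of a horizontal line. -/
theorem norm_Gamma_le (p d t : ℝ) (hp : 0 < p) (hd : 0 ≤ d) (ht : 1 ≤ |t|) :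
    ‖Complex.Gamma (p + t * Complex.I)‖ ≤
      gammaRatioConst d * |t| ^ (-d) * ‖Complex.Gamma ((p + d : ℝ) + t * Complex.I)‖ := by
  have ht0 : t ≠ 0 := fun h => by simp [h] at ht; linarith
  have hnz : ∀ x : ℝ, 0 < ‖(x : ℂ) + t * Complex.I‖ := fun x => by
    rw [norm_add_mul_I]; positivity
  set z : ℂ := p + t * Complex.I with hz
  -- The two Gauss approximants differ by a factor `n ^ d`, which combines with the telescoped power
  -- into a quotient tending to `1`.
  have hmain : ∀ n : ℕ, n ≠ 0 → ‖Complex.GammaSeq z n‖ ≤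
      gammaRatioConst d * ((‖((p + (n + 1 : ℕ) : ℝ) : ℂ) + t * Complex.I‖ / n) ^ d *
        ‖z‖ ^ (-d)) * ‖Complex.GammaSeq ((p + d : ℝ) + t * Complex.I) n‖ := by
    intro n hn
    have hn0 : (0 : ℝ) < n := by positivity
    have h := prod_norm_ratio_le p d t hp hd ht (n + 1)
    rw [Complex.GammaSeq, Complex.GammaSeq, norm_div, norm_div, norm_mul, norm_mul, norm_prod,
      norm_prod, Complex.norm_natCast_cpow_of_pos (Nat.pos_of_ne_zero hn),
      Complex.norm_natCast_cpow_of_pos (Nat.pos_of_ne_zero hn)]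
    have e1 : z.re = p := by simp [hz]
    have e2 : (((p + d : ℝ) : ℂ) + t * Complex.I).re = p + d := by simp
    rw [e1, e2, Real.rpow_add hn0]
    have e3 : ∀ j : ℕ, z + j = ((p + j : ℝ) : ℂ) + t * Complex.I := fun j => by
      rw [hz]; push_cast; ring
    have e4 : ∀ j : ℕ, ((p + d : ℝ) : ℂ) + t * Complex.I + j =
        ((p + d + j : ℝ) : ℂ) + t * Complex.I := fun j => by push_cast; ring
    simp only [e3, e4]
    set A := ∏ j ∈ Finset.range (n + 1), ‖((p + d + j : ℝ) : ℂ) + t * Complex.I‖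
    set B := ∏ j ∈ Finset.range (n + 1), ‖((p + j : ℝ) : ℂ) + t * Complex.I‖
    have hA : 0 < A := Finset.prod_pos fun j _ => hnz _
    have hB : 0 < B := Finset.prod_pos fun j _ => hnz _
    have hzn : 0 < ‖z‖ := hnz p
    set Q := ‖((p + (n + 1 : ℕ) : ℝ) : ℂ) + t * Complex.I‖
    have hQ : 0 < Q := hnz _
    rw [Real.div_rpow hQ.le hzn.le] at h
    rw [Real.div_rpow hQ.le hn0.le, Real.rpow_neg hzn.le, div_le_iff₀ hB]
    have hnd : 0 < (n : ℝ) ^ d := Real.rpow_pos_of_pos hn0 _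
    have hzd : 0 < ‖z‖ ^ d := Real.rpow_pos_of_pos hzn _
    calc (n : ℝ) ^ p * ‖((n.factorial : ℕ) : ℂ)‖
        = (n : ℝ) ^ p * ‖((n.factorial : ℕ) : ℂ)‖ / A * A := by field_simp
      _ ≤ (n : ℝ) ^ p * ‖((n.factorial : ℕ) : ℂ)‖ / A *
          (gammaRatioConst d * (Q ^ d / ‖z‖ ^ d) * B) := by gcongr
      _ = _ := by field_simp
  have hlim : Tendsto (fun n : ℕ => ‖((p + (n + 1 : ℕ) : ℝ) : ℂ) + t * Complex.I‖ / n) atTop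
      (𝓝 1) := by
    have h1 : Tendsto (fun n : ℕ => (((p + 1 : ℝ) : ℂ) + t * Complex.I) / (n : ℂ) + 1) atTop
        (𝓝 (0 + 1)) := (tendsto_const_div_atTop_nhds_zero_nat _).add_const _
    have h2 := h1.norm
    simp only [zero_add, norm_one] at h2
    refine h2.congr' ?_
    filter_upwards [eventually_ne_atTop 0] with n hn
    have : (n : ℂ) ≠ 0 := by exact_mod_cast hn
    rw [← Complex.norm_natCast n, ← norm_div]
    congr 1
    field_simp
    push_cast
    ring
  have hlim2 : Tendsto (fun n : ℕ => gammaRatioConst d *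
      ((‖((p + (n + 1 : ℕ) : ℝ) : ℂ) + t * Complex.I‖ / n) ^ d *
        ‖z‖ ^ (-d)) * ‖Complex.GammaSeq ((p + d : ℝ) + t * Complex.I) n‖) atTop
      (𝓝 (gammaRatioConst d * ((1 : ℝ) ^ d * ‖z‖ ^ (-d)) *
        ‖Complex.Gamma ((p + d : ℝ) + t * Complex.I)‖)) :=
    ((tendsto_const_nhds.mul ((hlim.rpow_const (Or.inl one_ne_zero)).mul_const _))).mul
      (Complex.GammaSeq_tendsto_Gamma _).norm
  have hle := le_of_tendsto_of_tendsto (Complex.GammaSeq_tendsto_Gamma z).norm hlim2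
    ((eventually_ne_atTop 0).mono hmain)
  refine hle.trans ?_
  rw [Real.one_rpow, one_mul]
  have : 0 < gammaRatioConst d := Real.exp_pos _
  gcongr ?_ * ?_ * ?_
  -- `|t| = |Im z| ≤ ‖z‖`, and the exponent `-d` reverses the inequality.
  refine Real.rpow_le_rpow_of_nonpos (abs_pos.2 ht0) ?_ (by linarith)
  have := Complex.abs_im_le_norm z
  simpa [hz] using this

/-! ### Fourier transform and Plancherel on `L¹ ∩ L²` -/

/-- For functions in `L¹ ∩ L²` the Fourier transform on `L²` is given by the Fourier integral. -/
theorem coeFn_fourier_toLp {h : ℝ → ℂ} (h1 : Integrable h) (h2 : MemLp h 2) :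
    ((𝓕 (h2.toLp h) : Lp ℂ 2 (volume : Measure ℝ)) : ℝ → ℂ) =ᵐ[volume] 𝓕 h := by
  have hc : Continuous (𝓕 h) :=
    VectorFourier.fourierIntegral_continuous (L := innerₗ ℝ) Real.continuous_fourierChar
      continuous_inner h1
  refine ae_eq_of_integral_contDiff_smul_eq ((Lp.memLp _).locallyIntegrable one_le_two)
    hc.locallyIntegrable ?_
  intro g hg1 hg2
  have hg3 : HasCompactSupport (Complex.ofRealCLM ∘ g) := hg2.comp_left rfl
  have hg4 : ContDiff ℝ ∞ (Complex.ofRealCLM ∘ g) := by fun_prop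
  set G := hg3.toSchwartzMap hg4 with hG
  -- The `L²` Fourier transform agrees with that of tempered distributions, so it can be moved onto
  -- the test function and then back onto `h` by the multiplication formula for integrals.
  have e1 : ∫ x, g x • (𝓕 (h2.toLp h) : Lp ℂ 2 (volume : Measure ℝ)) x =
      Lp.toTemperedDistribution (𝓕 (h2.toLp h)) G := by
    rw [Lp.toTemperedDistribution_apply]
    simp [hG]
  rw [e1, ← Lp.fourier_toTemperedDistribution_eq, TemperedDistribution.fourier_apply,
    Lp.toTemperedDistribution_apply]
  have e2 : ∫ x, (𝓕 G) x • (h2.toLp h) x = ∫ x, (𝓕 (G : ℝ → ℂ)) x • h x := by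
    refine integral_congr_ae ?_
    filter_upwards [h2.coeFn_toLp] with x hx
    rw [hx, SchwartzMap.fourier_coe]
  rw [e2]
  have e3 := VectorFourier.integral_fourierIntegral_smul_eq_flip (L := innerₗ ℝ)
      Real.continuous_fourierChar continuous_inner (G.integrable (μ := volume)) h1
  rw [flip_innerₗ] at e3
  refine Eq.trans e3 ?_
  simp [hG]
  rfl

theorem memLp_fourier {h : ℝ → ℂ} (h1 : Integrable h) (h2 : MemLp h 2) : MemLp (𝓕 h) 2 :=
  (memLp_congr_ae (coeFn_fourier_toLp h1 h2)).1 (Lp.memLp _)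

/-- Plancherel's theorem for functions in `L¹ ∩ L²`. -/
theorem eLpNorm_fourier {h : ℝ → ℂ} (h1 : Integrable h) (h2 : MemLp h 2) :
    eLpNorm (𝓕 h) 2 = eLpNorm h 2 := by
  have e := Lp.norm_fourier_eq (h2.toLp h)
  rw [Lp.norm_def, Lp.norm_def, ENNReal.toReal_eq_toReal_iff' (Lp.eLpNorm_ne_top _)
    (Lp.eLpNorm_ne_top _), eLpNorm_congr_ae (coeFn_fourier_toLp h1 h2),
    eLpNorm_congr_ae h2.coeFn_toLp] at e
  exact e

/-! ### Contour shifts and the two-sided Laplace transform -/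

/-- Shifting a vertical line of integration. -/
theorem integral_vertical_eq {f : ℂ → ℂ} {a b : ℝ} (hab : a ≤ b)
    (hf : ∀ z : ℂ, z.re ∈ Icc a b → DifferentiableAt ℂ f z)
    (ha : Integrable fun t : ℝ => f (a + t * Complex.I))
    (hb : Integrable fun t : ℝ => f (b + t * Complex.I))
    {ε : ℝ → ℝ} (hε : Tendsto ε atTop (𝓝 0))
    (hbd : ∀ x ∈ Icc a b, ∀ t : ℝ, 1 ≤ |t| → ‖f (x + t * Complex.I)‖ ≤ ε |t|) :
    ∫ t : ℝ, f (b + t * Complex.I) = ∫ t : ℝ, f (a + t * Complex.I) := by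
  have hrect : ∀ T : ℝ, (∫ t in (-T)..T, f (b + t * Complex.I)) -
      (∫ t in (-T)..T, f (a + t * Complex.I)) =
      Complex.I * ((∫ x in a..b, f (x + ((-T : ℝ) : ℂ) * Complex.I)) -
        ∫ x in a..b, f (x + (T : ℂ) * Complex.I)) := by
    intro T
    have h := Complex.integral_boundary_rect_eq_zero_of_differentiableOn f
      ((a : ℂ) + ((-T : ℝ) : ℂ) * Complex.I) ((b : ℂ) + (T : ℂ) * Complex.I) (by
        intro z hz
        refine (hf z ?_).differentiableWithinAt
        have := hz.1
        simpa [uIcc_of_le hab] using this)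
    simp only [Complex.add_re, Complex.add_im, Complex.ofReal_re, Complex.ofReal_im,
      Complex.mul_re, Complex.mul_im, Complex.I_re, Complex.I_im, mul_zero, mul_one, zero_add,
      add_zero, sub_zero, smul_eq_mul] at h
    linear_combination (-Complex.I) * h +
      ((∫ t in (-T)..T, f (b + t * Complex.I)) -
      (∫ t in (-T)..T, f (a + t * Complex.I))) * Complex.I_sq
  have hhor : ∀ T : ℝ, 1 ≤ |T| → ‖∫ x in a..b, f (x + (T : ℂ) * Complex.I)‖ ≤ ε |T| * |b - a| := by
    intro T hT
    refine intervalIntegral.norm_integral_le_of_norm_le_const fun x hx => ?_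
    rw [uIoc_of_le hab] at hx
    exact hbd x ⟨hx.1.le, hx.2⟩ T hT
  have hlim0 : Tendsto (fun T : ℝ => (∫ t in (-T)..T, f (b + t * Complex.I)) -
      (∫ t in (-T)..T, f (a + t * Complex.I))) atTop (𝓝 0) := by
    have hz : Tendsto (fun T : ℝ => 2 * (ε T * |b - a|)) atTop (𝓝 0) := by
      simpa using (hε.mul_const |b - a|).const_mul 2
    refine squeeze_zero_norm' ?_ hz
    filter_upwards [eventually_ge_atTop 1] with T hT
    have hT' : |T| = T := abs_of_nonneg (by linarith)
    rw [hrect T, norm_mul, Complex.norm_I, one_mul]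
    refine (norm_sub_le _ _).trans ?_
    have h1 := hhor (-T) (by rw [abs_neg, hT']; exact hT)
    have h2 := hhor T (by rw [hT']; exact hT)
    rw [abs_neg, hT'] at h1
    rw [hT'] at h2
    linarith
  have hlim1 := (intervalIntegral_tendsto_integral hb tendsto_neg_atTop_atBot tendsto_id).sub
    (intervalIntegral_tendsto_integral ha tendsto_neg_atTop_atBot tendsto_id)
  exact sub_eq_zero.1 (tendsto_nhds_unique hlim1 hlim0)

/-- The two-sided Laplace transform `z ↦ ∫ w(u) e^{zu} du`. -/
def laplace (w : ℝ → ℂ) (z : ℂ) : ℂ := ∫ u : ℝ, w u * Complex.exp (z * u)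

theorem integrable_mul_of_hasCompactSupport {w g : ℝ → ℂ} (hw : Continuous w)
    (hs : HasCompactSupport w) (hg : Continuous g) : Integrable fun u => w u * g u :=
  (hw.mul hg).integrable_of_hasCompactSupport hs.mul_right

theorem differentiable_laplace {w : ℝ → ℂ} (hw : Continuous w) (hs : HasCompactSupport w) :
    Differentiable ℂ (laplace w) := by
  intro z₀
  have h := hasDerivAt_integral_of_dominated_loc_of_deriv_le (𝕜 := ℂ) (μ := volume)
    (F := fun z u => w u * Complex.exp (z * u)) (x₀ := z₀)
    (F' := fun z (u : ℝ) => w u * (Complex.exp (z * u) * u)) (s := Metric.ball z₀ 1)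
    (bound := fun u => ‖w u * ((Real.exp ((‖z₀‖ + 1) * |u|) * |u| : ℝ) : ℂ)‖)
    (Metric.ball_mem_nhds _ one_pos)
    (Eventually.of_forall fun z => by
      have : Continuous fun u : ℝ => w u * Complex.exp (z * u) := by fun_prop
      exact this.aestronglyMeasurable)
    (integrable_mul_of_hasCompactSupport hw hs (by fun_prop))
    (by
      have : Continuous fun u : ℝ => w u * (Complex.exp (z₀ * u) * u) := by fun_prop
      exact this.aestronglyMeasurable)
    (Eventually.of_forall fun u z hz => ?_)
    (integrable_mul_of_hasCompactSupport hw hs (by fun_prop)).norm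
    (Eventually.of_forall fun u z _ => ?_)
  · exact h.2.differentiableAt
  · simp only [norm_mul, Complex.norm_real, Real.norm_eq_abs, abs_abs, Real.abs_exp,
      Complex.norm_exp]
    gcongr
    refine (Complex.re_le_norm _).trans ?_
    rw [norm_mul, Complex.norm_real, Real.norm_eq_abs]
    gcongr
    have := norm_sub_norm_le z z₀
    rw [Metric.mem_ball, dist_eq_norm] at hz
    linarith
  · have h1 : HasDerivAt (fun z : ℂ => z * (u : ℂ)) (u : ℂ) z := by
      simpa using (hasDerivAt_id z).mul_const (u : ℂ)
    exact (h1.cexp).const_mul _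

/-- Integration by parts without boundary terms. Applied twice it yields the quadratic decay on
vertical strips. -/
theorem laplace_deriv {w : ℝ → ℂ} (hw : ContDiff ℝ 1 w) (hs : HasCompactSupport w) (z : ℂ) :
    laplace (deriv w) z = -z * laplace w z := by
  have hd : ∀ u : ℝ, HasDerivAt (fun u : ℝ => Complex.exp (z * u)) (z * Complex.exp (z * u)) u := by
    intro u
    have h1 : HasDerivAt (fun u : ℝ => z * (u : ℂ)) z u := by
      simpa using (Complex.ofRealCLM.hasDerivAt (x := u)).const_mul z
    simpa [mul_comm] using h1.cexp
  have h := integral_mul_deriv_eq_deriv_mul_of_integrable (u := w) (u' := deriv w)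
    (v := fun u : ℝ => Complex.exp (z * u)) (v' := fun u : ℝ => z * Complex.exp (z * u))
    (fun u _ => (hw.differentiable one_ne_zero u).hasDerivAt) (fun u _ => hd u)
    (integrable_mul_of_hasCompactSupport hw.continuous hs (by fun_prop))
    (integrable_mul_of_hasCompactSupport (hw.continuous_deriv le_rfl) hs.deriv (by fun_prop))
    (integrable_mul_of_hasCompactSupport hw.continuous hs (by fun_prop))
  have h2 : ∫ u : ℝ, w u * (z * Complex.exp (z * u)) = z * laplace w z := by
    rw [laplace, ← integral_const_mul]
    congr with u
    ring
  rw [h2] at h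
  rw [neg_mul, h, neg_neg, laplace]

theorem norm_laplace_le {w : ℝ → ℂ} (hw : Continuous w) (hs : HasCompactSupport w) {δ : ℝ} (z : ℂ)
    (hz : |z.re| ≤ δ) : ‖laplace w z‖ ≤ ∫ u, ‖w u * ((Real.exp (δ * |u|) : ℝ) : ℂ)‖ := by
  refine (norm_integral_le_integral_norm _).trans ?_
  refine integral_mono (integrable_mul_of_hasCompactSupport hw hs (by fun_prop)).norm
    (integrable_mul_of_hasCompactSupport hw hs (by fun_prop)).norm fun u => ?_
  simp only [norm_mul, Complex.norm_real, Real.norm_eq_abs, Real.abs_exp, Complex.norm_exp]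
  gcongr
  have : (z * u).re = z.re * u := by simp
  rw [this]
  exact (le_abs_self _).trans (by rw [abs_mul]; gcongr)

/-- The Laplace transform of a smooth compactly supported function decays quadratically on
vertical strips. -/
theorem exists_norm_laplace_le {w : ℝ → ℂ} (hw : ContDiff ℝ ∞ w) (hs : HasCompactSupport w)
    (δ : ℝ) : ∃ C, 0 ≤ C ∧ ∀ z : ℂ, |z.re| ≤ δ → ‖laplace w z‖ * (1 + z.im ^ 2) ≤ C := by
  have hw1 : ContDiff ℝ ∞ (deriv w) := (contDiff_infty_iff_deriv.1 hw).2
  have hw2 : ContDiff ℝ ∞ (deriv (deriv w)) := (contDiff_infty_iff_deriv.1 hw1).2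
  refine ⟨(∫ u, ‖w u * ((Real.exp (δ * |u|) : ℝ) : ℂ)‖) +
    ∫ u, ‖deriv (deriv w) u * ((Real.exp (δ * |u|) : ℝ) : ℂ)‖,
    add_nonneg (integral_nonneg fun _ => norm_nonneg _) (integral_nonneg fun _ => norm_nonneg _),
    fun z hz => ?_⟩
  have h1 := norm_laplace_le hw.continuous hs z hz
  have h2 := norm_laplace_le hw2.continuous hs.deriv.deriv z hz
  rw [laplace_deriv (hw1.of_le (mod_cast le_top)) hs.deriv,
    laplace_deriv (hw.of_le (mod_cast le_top)) hs, norm_mul, norm_mul, norm_neg] at h2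
  have h3 : z.im ^ 2 ≤ ‖z‖ ^ 2 := by
    rw [← sq_abs]
    gcongr
    exact Complex.abs_im_le_norm z
  nlinarith [norm_nonneg (laplace w z), mul_le_mul_of_nonneg_left h3 (norm_nonneg (laplace w z))]

theorem laplace_eq_fourier (w : ℝ → ℂ) (ξ : ℝ) :
    laplace w (((-2 * Real.pi * ξ : ℝ) : ℂ) * Complex.I) = 𝓕 w ξ := by
  rw [Real.fourier_eq', laplace]
  congr with u
  rw [smul_eq_mul, mul_comm]
  congr 2
  simp
  ring

/-! ### Kernels `k(v + u)` as Fourier multipliers -/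

/-- The inverse Laplace transform of `m` along the line `Re z = δ`. -/
def lineKernel (m : ℂ → ℂ) (δ v : ℝ) : ℂ :=
  1 / (2 * Real.pi) * ∫ t : ℝ, m (δ + t * Complex.I) * Complex.exp ((δ + t * Complex.I) * v)

/-- Fubini: `e^{z(v+u)}` factors, and the inner integral over `u` is the Laplace transform of `w`.
Compact support of `w` and integrability of `m` on the line give absolute convergence. -/
theorem lineKernel_integral_eq {m : ℂ → ℂ} {δ : ℝ}
    (hint : Integrable fun t : ℝ => m (δ + t * Complex.I)) {w : ℝ → ℂ} (hw : Continuous w)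
    (hs : HasCompactSupport w) (v : ℝ) :
    ∫ u, lineKernel m δ (v + u) * w u =
      1 / (2 * Real.pi) * ∫ t : ℝ, m (δ + t * Complex.I) * laplace w (δ + t * Complex.I) *
        Complex.exp ((δ + t * Complex.I) * v) := by
  have hprod : Integrable (Function.uncurry fun u t : ℝ => m (δ + t * Complex.I) *
      Complex.exp ((δ + t * Complex.I) * (v + u : ℝ)) * w u) (volume.prod volume) := by
    have h1 : Integrable fun u : ℝ => w u * ((Real.exp (δ * (v + u)) : ℝ) : ℂ) :=
      integrable_mul_of_hasCompactSupport hw hs (by fun_prop)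
    have h2 := h1.mul_prod hint
    refine h2.mono ?_ (Eventually.of_forall fun p => ?_)
    · have h3 : Continuous fun p : ℝ × ℝ =>
          Complex.exp ((δ + p.2 * Complex.I) * (v + p.1 : ℝ)) * w p.1 := by fun_prop
      refine (hint.aestronglyMeasurable.comp_snd.mul h3.aestronglyMeasurable).congr
        (Eventually.of_forall fun p => ?_)
      simp [Function.uncurry, mul_assoc]
    · simp only [Function.uncurry, norm_mul, Complex.norm_exp, Complex.norm_real,
        Real.norm_eq_abs, Real.abs_exp]
      have : ((δ + p.2 * Complex.I) * (v + p.1 : ℝ)).re = δ * (v + p.1) := by simp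
      rw [this]
      exact le_of_eq (by ring)
  calc ∫ u, lineKernel m δ (v + u) * w u
      = 1 / (2 * Real.pi) * ∫ u, ∫ t : ℝ, m (δ + t * Complex.I) *
      Complex.exp ((δ + t * Complex.I) * (v + u : ℝ)) * w u := by
        rw [← integral_const_mul]
        congr with u
        rw [integral_mul_const, lineKernel, mul_assoc]
    _ = 1 / (2 * Real.pi) * ∫ t : ℝ, ∫ u, m (δ + t * Complex.I) *
      Complex.exp ((δ + t * Complex.I) * (v + u : ℝ)) * w u := by
        rw [integral_integral_swap hprod]
    _ = _ := by
        congr 2 with t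
        rw [laplace, ← integral_const_mul, ← integral_mul_const]
        congr with u
        rw [Complex.ofReal_add, mul_add, Complex.exp_add]
        ring

/-- Convolution type operator with kernel `k(v + u)`, as a Fourier multiplier. -/
theorem lineKernel_integral_eq_fourier {m : ℂ → ℂ} {δ B : ℝ} (hδ : 0 ≤ δ)
    (hm : ∀ z : ℂ, z.re ∈ Icc 0 δ → DifferentiableAt ℂ m z)
    (hB : ∀ x ∈ Icc 0 δ, ∀ t : ℝ, 1 ≤ |t| → ‖m (x + t * Complex.I)‖ ≤ B)
    (hone : ∀ t : ℝ, ‖m (t * Complex.I)‖ = 1)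
    (hint : Integrable fun t : ℝ => m (δ + t * Complex.I)) {w : ℝ → ℂ} (hw : ContDiff ℝ ∞ w)
    (hs : HasCompactSupport w) (v : ℝ) :
    ∫ u, lineKernel m δ (v + u) * w u =
      𝓕 (fun ξ : ℝ => m (((-2 * Real.pi * ξ : ℝ) : ℂ) * Complex.I) * 𝓕 w ξ) v := by
  obtain ⟨C, hC0, hC⟩ := exists_norm_laplace_le hw hs δ
  have hL := differentiable_laplace hw.continuous hs
  rw [lineKernel_integral_eq hint hw.continuous hs]
  set f : ℂ → ℂ := fun z => m z * laplace w z * Complex.exp (z * v) with hf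
  have hfd : ∀ z : ℂ, z.re ∈ Icc 0 δ → DifferentiableAt ℂ f z := fun z hz =>
    ((hm z hz).mul (hL z)).mul (by fun_prop)
  have hLb : ∀ x ∈ Icc 0 δ, ∀ t : ℝ, ‖laplace w (x + t * Complex.I)‖ ≤ C * (1 + t ^ 2)⁻¹ := by
    intro x hx t
    have := hC (x + t * Complex.I) (by simpa [abs_of_nonneg hx.1] using hx.2)
    rw [← div_eq_mul_inv, le_div_iff₀ (by positivity)]
    simpa using this
  have hexp : ∀ x ∈ Icc 0 δ, ∀ t : ℝ, ‖Complex.exp ((x + t * Complex.I) * v)‖ ≤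
      Real.exp (δ * |v|) := by
    intro x hx t
    rw [Complex.norm_exp]
    refine Real.exp_le_exp.2 ?_
    have : ((x + t * Complex.I) * v : ℂ).re = x * v := by simp
    rw [this]
    calc x * v ≤ |x * v| := le_abs_self _
      _ = x * |v| := by rw [abs_mul, abs_of_nonneg hx.1]
      _ ≤ _ := by gcongr; exact hx.2
  have hcont : ∀ x ∈ Icc 0 δ, Continuous fun t : ℝ => f (x + t * Complex.I) := by
    intro x hx
    refine continuous_iff_continuousAt.2 fun t => ?_
    have h1 : ContinuousAt f (x + t * Complex.I) := (hfd _ (by simpa using hx)).continuousAt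
    exact ContinuousAt.comp (f := fun t : ℝ => (x + t * Complex.I : ℂ)) h1 (by fun_prop)
  have h0 : (0 : ℝ) ∈ Icc 0 δ := ⟨le_rfl, hδ⟩
  have hδm : δ ∈ Icc 0 δ := ⟨hδ, le_rfl⟩
  have ha : Integrable fun t : ℝ => f ((0 : ℝ) + t * Complex.I) := by
    refine ((integrable_inv_one_add_sq.const_mul C).mul_const (Real.exp (δ * |v|))).mono'
      (hcont 0 h0).aestronglyMeasurable (Eventually.of_forall fun t => ?_)
    have h1 := hLb 0 h0 t
    have h2 := hexp 0 h0 t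
    rw [hf]
    simp only [Complex.ofReal_zero, zero_add] at h1 h2 ⊢
    rw [norm_mul, norm_mul, hone, one_mul]
    exact mul_le_mul h1 h2 (norm_nonneg _) (by positivity)
  have hb : Integrable fun t : ℝ => f (δ + t * Complex.I) := by
    refine (hint.norm.mul_const (C * Real.exp (δ * |v|))).mono'
      (hcont δ hδm).aestronglyMeasurable (Eventually.of_forall fun t => ?_)
    rw [hf]
    simp only [norm_mul]
    rw [mul_assoc]
    gcongr
    · refine (hLb δ hδm t).trans (mul_le_of_le_one_right hC0 ?_)
      exact inv_le_one_of_one_le₀ (by nlinarith [sq_nonneg t])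
    · exact hexp δ hδm t
  have hε : Tendsto (fun t : ℝ => |B| * (C * t⁻¹) * Real.exp (δ * |v|)) atTop (𝓝 0) := by
    simpa using ((tendsto_inv_atTop_zero.const_mul C).const_mul |B|).mul_const
      (Real.exp (δ * |v|))
  -- The line moves from `Re z = δ`, where `m` is integrable, to `Re z = 0`, where it is unimodular.
  -- The bound `B` on `m` and the decay of `laplace w` remove the horizontal sides.
  have hshift := integral_vertical_eq hδ hfd ha hb hε (by
    intro x hx t ht
    rw [hf]
    simp only [norm_mul]
    have ht0 : 0 < |t| := by linarith
    gcongr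
    · exact (hB x hx t ht).trans (le_abs_self _)
    · refine (hLb x hx t).trans ?_
      gcongr
      rw [← sq_abs]
      nlinarith
    · exact hexp x hx t)
  rw [hshift, Real.fourier_eq']
  -- The substitution `t = -2πξ` turns `e^{itv}` into the character of the forward Fourier
  -- transform, so `𝓕` appears twice and no inverse is needed.
  have hsub := Measure.integral_comp_mul_left (fun t : ℝ => f (t * Complex.I)) (-2 * Real.pi)
  have hpi : |(-2 * Real.pi)⁻¹| = 1 / (2 * Real.pi) := by
    rw [abs_inv, abs_mul, abs_of_pos Real.pi_pos]
    norm_num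
  rw [hpi] at hsub
  have e1 : (1 / (2 * Real.pi) : ℂ) * ∫ t : ℝ, f ((0 : ℝ) + t * Complex.I) =
      (1 / (2 * Real.pi) : ℝ) • ∫ t : ℝ, f (t * Complex.I) := by
    rw [Complex.real_smul]
    simp
  rw [e1, ← hsub]
  congr with ξ
  rw [hf]
  dsimp only
  rw [laplace_eq_fourier, smul_eq_mul, mul_comm]
  congr 2
  simp
  ring

/-- The operator with kernel `k(v + u)` is isometric on smooth compactly supported functions. -/
theorem eLpNorm_lineKernel_integral {m : ℂ → ℂ} {δ B : ℝ} (hδ : 0 ≤ δ)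
    (hm : ∀ z : ℂ, z.re ∈ Icc 0 δ → DifferentiableAt ℂ m z)
    (hB : ∀ x ∈ Icc 0 δ, ∀ t : ℝ, 1 ≤ |t| → ‖m (x + t * Complex.I)‖ ≤ B)
    (hone : ∀ t : ℝ, ‖m (t * Complex.I)‖ = 1)
    (hint : Integrable fun t : ℝ => m (δ + t * Complex.I)) {w : ℝ → ℂ} (hw : ContDiff ℝ ∞ w)
    (hs : HasCompactSupport w) :
    eLpNorm (fun v => ∫ u, lineKernel m δ (v + u) * w u) 2 volume = eLpNorm w 2 volume := by
  have hw1 : Integrable w := hw.continuous.integrable_of_hasCompactSupport hs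
  have hw2 : MemLp w 2 := hw.continuous.memLp_of_hasCompactSupport hs
  have hF : Integrable (𝓕 w) := by
    have := (𝓕 (hs.toSchwartzMap hw)).integrable (μ := volume)
    rwa [SchwartzMap.fourier_coe] at this
  have hF2 := memLp_fourier hw1 hw2
  set h : ℝ → ℂ := fun ξ : ℝ => m (((-2 * Real.pi * ξ : ℝ) : ℂ) * Complex.I) * 𝓕 w ξ with hh
  have hnorm : ∀ ξ, ‖h ξ‖ = ‖𝓕 w ξ‖ := fun ξ => by rw [hh]; simp only [norm_mul, hone, one_mul]
  have hmeas : AEStronglyMeasurable h volume := by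
    have hc : Continuous fun ξ : ℝ => m (((-2 * Real.pi * ξ : ℝ) : ℂ) * Complex.I) := by
      refine continuous_iff_continuousAt.2 fun ξ => ?_
      have h1 : ContinuousAt m (((-2 * Real.pi * ξ : ℝ) : ℂ) * Complex.I) :=
        (hm _ (by simpa using hδ)).continuousAt
      exact ContinuousAt.comp
        (f := fun ξ : ℝ => (((-2 * Real.pi * ξ : ℝ) : ℂ) * Complex.I)) h1 (by fun_prop)
    exact hc.aestronglyMeasurable.mul hF.aestronglyMeasurable
  have hi : Integrable h := hF.congr' hmeas (Eventually.of_forall fun ξ => (hnorm ξ).symm)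
  have hi2 : MemLp h 2 := hF2.congr_norm hmeas (Eventually.of_forall fun ξ => (hnorm ξ).symm)
  have heq : (fun v => ∫ u, lineKernel m δ (v + u) * w u) = 𝓕 h := by
    ext v
    exact lineKernel_integral_eq_fourier hδ hm hB hone hint hw hs v
  rw [heq, eLpNorm_fourier hi hi2, eLpNorm_congr_norm_ae (Eventually.of_forall hnorm),
    eLpNorm_fourier hw1 hw2]

/-! ### Gamma quotients and the Mellin multiplier -/

/-- The quotient `Γ(b - l) / Γ(γ + b + l)`. -/
def gammaQuot (b γ : ℝ) (l : ℂ) : ℂ := Complex.Gamma (b - l) / Complex.Gamma (γ + b + l)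

theorem differentiableAt_Gamma_of_re_pos {z : ℂ} (hz : 0 < z.re) :
    DifferentiableAt ℂ Complex.Gamma z := by
  refine Complex.differentiableAt_Gamma z fun n h => ?_
  rw [h] at hz
  simp at hz
  have : (0 : ℝ) ≤ n := n.cast_nonneg
  linarith

theorem differentiableAt_gammaQuot {b γ : ℝ} {l : ℂ} (h1 : l.re < b) (h2 : 0 < γ + b + l.re) :
    DifferentiableAt ℂ (gammaQuot b γ) l := by
  have e1 : 0 < ((b : ℂ) - l).re := by simpa using h1
  have e2 : 0 < ((γ : ℂ) + b + l).re := by simpa using h2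
  refine DifferentiableAt.div ?_ ?_ (Complex.Gamma_ne_zero_of_re_pos e2)
  · exact DifferentiableAt.comp (g := Complex.Gamma) (f := fun l : ℂ => (b : ℂ) - l) l
      (differentiableAt_Gamma_of_re_pos e1) (by fun_prop)
  · exact DifferentiableAt.comp (g := Complex.Gamma) (f := fun l : ℂ => (γ : ℂ) + b + l) l
      (differentiableAt_Gamma_of_re_pos e2) (by fun_prop)

theorem gammaQuot_conj (b γ : ℝ) (l : ℂ) : gammaQuot b γ (conj l) = conj (gammaQuot b γ l) := by
  simp [gammaQuot, ← Complex.Gamma_conj]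

theorem norm_Gamma_sub_mul_I (p t : ℝ) :
    ‖Complex.Gamma (p - t * Complex.I)‖ = ‖Complex.Gamma (p + t * Complex.I)‖ := by
  rw [← Complex.norm_conj (Complex.Gamma (p + t * Complex.I)), ← Complex.Gamma_conj]
  simp [sub_eq_add_neg]

/-- As `b` and `σ` are real, the numerator has the same norm at the conjugate point. The two
arguments then lie on one horizontal line at distance `γ + 2σ`, and `norm_Gamma_le` applies. -/
theorem norm_gammaQuot_le {b γ σ t : ℝ} (h1 : σ < b) (h2 : 0 ≤ γ + 2 * σ) (ht : 1 ≤ |t|) :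
    ‖gammaQuot b γ (σ + t * Complex.I)‖ ≤
      gammaRatioConst (γ + 2 * σ) * |t| ^ (-(γ + 2 * σ)) := by
  have h := norm_Gamma_le (b - σ) (γ + 2 * σ) t (by linarith) h2 ht
  have e1 : (b : ℂ) - (σ + t * Complex.I) = ((b - σ : ℝ) : ℂ) - t * Complex.I := by
    push_cast; ring
  have e2 : (γ : ℂ) + b + (σ + t * Complex.I) =
      ((b - σ + (γ + 2 * σ) : ℝ) : ℂ) + t * Complex.I := by
    push_cast; ring
  rw [gammaQuot, e1, e2, norm_div, norm_Gamma_sub_mul_I, div_le_iff₀]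
  · exact h
  · refine norm_pos_iff.2 (Complex.Gamma_ne_zero_of_re_pos ?_)
    simp
    linarith

/-- On this line the arguments of numerator and denominator are complex conjugates. This is the
source of unitarity. -/
theorem norm_gammaQuot_eq_one {b γ : ℝ} (h : 0 < b + γ / 2) (t : ℝ) :
    ‖gammaQuot b γ ((-γ / 2 : ℝ) + t * Complex.I)‖ = 1 := by
  have e1 : (b : ℂ) - ((-γ / 2 : ℝ) + t * Complex.I) = ((b + γ / 2 : ℝ) : ℂ) - t * Complex.I := by
    push_cast; ring
  have e2 : (γ : ℂ) + b + ((-γ / 2 : ℝ) + t * Complex.I) =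
      ((b + γ / 2 : ℝ) : ℂ) + t * Complex.I := by
    push_cast; ring
  rw [gammaQuot, e1, e2, norm_div, norm_Gamma_sub_mul_I, div_self]
  refine norm_ne_zero_iff.2 (Complex.Gamma_ne_zero_of_re_pos ?_)
  simpa using h

theorem gammaRatioConst_mono {d e : ℝ} (hd : 0 ≤ d) (hde : d ≤ e) :
    gammaRatioConst d ≤ gammaRatioConst e := by
  refine Real.exp_le_exp.2 ?_
  have : 0 ≤ ∑' j : ℕ, 1 / ((j : ℝ) ^ 2 + 1) := tsum_nonneg fun j => by positivity
  gcongr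
  exact hd.trans hde

/-- The Mellin multiplier of the transform with kernel `gKernel`, normalized so that the critical
line is `Re z = 0`. -/
def gSymbol (b₁ b₂ γ : ℝ) (z : ℂ) : ℂ :=
  gammaQuot b₁ γ (γ * (z - 1 / 2)) * gammaQuot b₂ γ (γ * (z - 1 / 2))

/-- The abscissa of the contour of `gKernel` in the normalization of `gSymbol`. -/
def gAbscissa (b₁ b₂ γ : ℝ) : ℝ := (min b₁ b₂ - 1 / 8) / γ + 1 / 2

section

variable {b₁ b₂ γ : ℝ}

theorem gSymbol_conj (z : ℂ) : gSymbol b₁ b₂ γ (conj z) = conj (gSymbol b₁ b₂ γ z) := by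
  have : (γ : ℂ) * (conj z - 1 / 2) = conj ((γ : ℂ) * (z - 1 / 2)) := by
    have h2 : conj (2 : ℂ) = 2 := map_ofNat _ 2
    simp [h2]
  rw [gSymbol, this, gammaQuot_conj, gammaQuot_conj, gSymbol, map_mul]

theorem gSymbol_line (x t : ℝ) : gSymbol b₁ b₂ γ (x + t * Complex.I) =
    gammaQuot b₁ γ ((γ * (x - 1 / 2) : ℝ) + (γ * t : ℝ) * Complex.I) *
      gammaQuot b₂ γ ((γ * (x - 1 / 2) : ℝ) + (γ * t : ℝ) * Complex.I) := by
  have : (γ : ℂ) * ((x + t * Complex.I) - 1 / 2) =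
      (γ * (x - 1 / 2) : ℝ) + (γ * t : ℝ) * Complex.I := by push_cast; ring
  rw [gSymbol, this]

/-- The lower bounds on the `b_j` give `γδ ≥ 1/2 - 1/8 = 3/8`, so the contour lies strictly to the
right of the critical line. -/
theorem gAbscissa_pos (hγ : 1 ≤ γ) (h₁ : (1 - γ) / 2 ≤ b₁) (h₂ : (1 - γ) / 2 ≤ b₂) :
    0 < gAbscissa b₁ b₂ γ := by
  have h := le_min h₁ h₂
  have hγ0 : 0 < γ := by linarith
  rw [gAbscissa, div_add_div _ _ hγ0.ne' two_ne_zero]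
  apply div_pos <;> linarith

theorem mul_gAbscissa (hγ : 1 ≤ γ) :
    γ * (gAbscissa b₁ b₂ γ - 1 / 2) = min b₁ b₂ - 1 / 8 := by
  rw [gAbscissa]
  field_simp
  ring

/-- In the closed strip between the critical line and the contour, `λ = γ(z - 1/2)` stays to the
left of all poles of the numerator; the bound `Re λ ≥ -γ/2` serves to keep the arguments of the
denominator in the right half-plane. -/
theorem mul_sub_mem {x : ℝ} (hγ : 1 ≤ γ) (hx : x ∈ Icc 0 (gAbscissa b₁ b₂ γ)) :
    -γ / 2 ≤ γ * (x - 1 / 2) ∧ γ * (x - 1 / 2) < b₁ ∧ γ * (x - 1 / 2) < b₂ := by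
  have h1 : γ * (x - 1 / 2) ≤ min b₁ b₂ - 1 / 8 := by
    rw [← mul_gAbscissa hγ]
    gcongr
    exact hx.2
  refine ⟨by nlinarith [hx.1], ?_, ?_⟩
  · linarith [min_le_left b₁ b₂]
  · linarith [min_le_right b₁ b₂]

theorem differentiableAt_gSymbol (hγ : 1 ≤ γ) (h₁ : (1 - γ) / 2 ≤ b₁) (h₂ : (1 - γ) / 2 ≤ b₂)
    (z : ℂ) (hz : z.re ∈ Icc 0 (gAbscissa b₁ b₂ γ)) :
    DifferentiableAt ℂ (gSymbol b₁ b₂ γ) z := by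
  obtain ⟨e1, e2, e3⟩ := mul_sub_mem hγ hz
  have hre : ((γ : ℂ) * (z - 1 / 2)).re = γ * (z.re - 1 / 2) := by simp
  refine DifferentiableAt.mul ?_ ?_
  · exact DifferentiableAt.comp (g := gammaQuot b₁ γ) (f := fun z : ℂ => (γ : ℂ) * (z - 1 / 2)) z
      (differentiableAt_gammaQuot (by rwa [hre]) (by rw [hre]; linarith)) (by fun_prop)
  · exact DifferentiableAt.comp (g := gammaQuot b₂ γ) (f := fun z : ℂ => (γ : ℂ) * (z - 1 / 2)) z
      (differentiableAt_gammaQuot (by rwa [hre]) (by rw [hre]; linarith)) (by fun_prop)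

/-- Each Gamma quotient contributes `|γt|^{-2γx}`, and `γ ≥ 1` lets `|t|` replace `|γt|`. By
monotonicity the constant can be taken at the right edge, hence is uniform on the strip. -/
theorem norm_gSymbol_le (hγ : 1 ≤ γ) {x t : ℝ}
    (hx : x ∈ Icc 0 (gAbscissa b₁ b₂ γ)) (ht : 1 ≤ |t|) :
    ‖gSymbol b₁ b₂ γ (x + t * Complex.I)‖ ≤
      gammaRatioConst (2 * γ * gAbscissa b₁ b₂ γ) ^ 2 * |t| ^ (-(4 * γ * x)) := by
  obtain ⟨e1, e2, e3⟩ := mul_sub_mem hγ hx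
  have hd : γ + 2 * (γ * (x - 1 / 2)) = 2 * γ * x := by ring
  have hd0 : 0 ≤ 2 * γ * x := by have := hx.1; positivity
  have htpos : 0 < |t| := by linarith
  have hle : |t| ≤ |γ * t| := by
    rw [abs_mul, abs_of_nonneg (show 0 ≤ γ by linarith)]
    nlinarith
  have hbd : ∀ b : ℝ, γ * (x - 1 / 2) < b →
      ‖gammaQuot b γ ((γ * (x - 1 / 2) : ℝ) + (γ * t : ℝ) * Complex.I)‖ ≤
        gammaRatioConst (2 * γ * gAbscissa b₁ b₂ γ) * |t| ^ (-(2 * γ * x)) := by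
    intro b hb
    have h := norm_gammaQuot_le (γ := γ) hb (by linarith) (ht.trans hle)
    rw [hd] at h
    refine h.trans ?_
    gcongr ?_ * ?_
    · exact (Real.exp_pos _).le
    · exact gammaRatioConst_mono hd0 (by have := hx.2; gcongr)
    · exact Real.rpow_le_rpow_of_nonpos htpos hle (by linarith)
  rw [gSymbol_line, norm_mul]
  refine (mul_le_mul (hbd b₁ e2) (hbd b₂ e3) (norm_nonneg _) ?_).trans (le_of_eq ?_)
  · have : 0 < gammaRatioConst (2 * γ * gAbscissa b₁ b₂ γ) := Real.exp_pos _
    positivity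
  · have : -(4 * γ * x) = -(2 * γ * x) + -(2 * γ * x) := by ring
    rw [this, Real.rpow_add htpos]
    ring

theorem norm_gSymbol_le_const (hγ : 1 ≤ γ) (x : ℝ) (hx : x ∈ Icc 0 (gAbscissa b₁ b₂ γ)) (t : ℝ)
    (ht : 1 ≤ |t|) : ‖gSymbol b₁ b₂ γ (x + t * Complex.I)‖ ≤
      gammaRatioConst (2 * γ * gAbscissa b₁ b₂ γ) ^ 2 := by
  refine (norm_gSymbol_le hγ hx ht).trans (mul_le_of_le_one_right (sq_nonneg _) ?_)
  refine Real.rpow_le_one_of_one_le_of_nonpos ht ?_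
  have := hx.1
  have : 0 ≤ 4 * γ * x := by positivity
  linarith

theorem norm_gSymbol_eq_one (h₁ : (1 - γ) / 2 ≤ b₁) (h₂ : (1 - γ) / 2 ≤ b₂) (t : ℝ) :
    ‖gSymbol b₁ b₂ γ (t * Complex.I)‖ = 1 := by
  have h := gSymbol_line (b₁ := b₁) (b₂ := b₂) (γ := γ) 0 t
  have e : γ * (0 - 1 / 2) = -γ / 2 := by ring
  rw [Complex.ofReal_zero, zero_add, e] at h
  rw [h, norm_mul, norm_gammaQuot_eq_one (by linarith), norm_gammaQuot_eq_one (by linarith),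
    one_mul]

theorem integrable_gSymbol (hγ : 1 ≤ γ) (h₁ : (1 - γ) / 2 ≤ b₁) (h₂ : (1 - γ) / 2 ≤ b₂) :
    Integrable fun t : ℝ => gSymbol b₁ b₂ γ (gAbscissa b₁ b₂ γ + t * Complex.I) := by
  set δ := gAbscissa b₁ b₂ γ with hδ
  have hδm : δ ∈ Icc 0 δ := ⟨(gAbscissa_pos hγ h₁ h₂).le, le_rfl⟩
  have hcont : Continuous fun t : ℝ => gSymbol b₁ b₂ γ (δ + t * Complex.I) := by
    refine continuous_iff_continuousAt.2 fun t => ?_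
    have h1 : ContinuousAt (gSymbol b₁ b₂ γ) (δ + t * Complex.I) :=
      (differentiableAt_gSymbol hγ h₁ h₂ _ (by
        have : (δ + t * Complex.I : ℂ).re = δ := by simp
        rw [this]
        exact hδm)).continuousAt
    exact ContinuousAt.comp (f := fun t : ℝ => (δ + t * Complex.I : ℂ)) h1 (by fun_prop)
  obtain ⟨M, hM⟩ := (isCompact_Icc (a := (-1 : ℝ)) (b := 1)).exists_bound_of_continuousOn
    hcont.continuousOn
  -- `γδ ≥ 3/8`, so the symbol decays at least like `|t|^{-3/2}`, which is integrable.
  have h32 : (3 / 2 : ℝ) ≤ 4 * γ * δ := by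
    have := mul_gAbscissa (b₁ := b₁) (b₂ := b₂) hγ
    have := le_min h₁ h₂
    nlinarith
  set A := gammaRatioConst (2 * γ * δ) ^ 2
  have hA : 0 ≤ A := sq_nonneg _
  have hbr : Integrable (fun t : ℝ => (1 + ‖t‖) ^ (-(3 / 2 : ℝ))) := by
    refine integrable_one_add_norm ?_
    simp
    norm_num
  refine (hbr.const_mul ((|M| + A) * 2 ^ (3 / 2 : ℝ))).mono' hcont.aestronglyMeasurable
    (Eventually.of_forall fun t => ?_)
  -- Used with `s = 1` for `|t| ≤ 1` and with `s = |t|` otherwise, to compare with one global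
  -- integrable function.
  have hk : ∀ s : ℝ, 0 < s → 1 + |t| ≤ 2 * s →
      s ^ (-(3 / 2 : ℝ)) ≤ 2 ^ (3 / 2 : ℝ) * (1 + |t|) ^ (-(3 / 2 : ℝ)) := by
    intro s hs hle
    have h0 : 0 < 1 + |t| := by positivity
    have := Real.rpow_le_rpow_of_nonpos h0 hle (show (-(3 / 2 : ℝ)) ≤ 0 by norm_num)
    rw [Real.mul_rpow zero_le_two hs.le, Real.rpow_neg zero_le_two,
      inv_mul_le_iff₀ (by positivity)] at this
    exact this
  rw [mul_assoc, Real.norm_eq_abs]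
  rcases le_total |t| 1 with ht | ht
  · have h1 := hk 1 one_pos (by linarith)
    rw [Real.one_rpow] at h1
    calc _ ≤ M := hM t (abs_le.1 ht)
      _ ≤ (|M| + A) * 1 := by linarith [le_abs_self M]
      _ ≤ _ := by gcongr
  · have h1 := hk |t| (by linarith) (by linarith)
    calc _ ≤ A * |t| ^ (-(4 * γ * δ)) := norm_gSymbol_le hγ hδm ht
      _ ≤ (|M| + A) * |t| ^ (-(3 / 2 : ℝ)) := by
        gcongr ?_ * ?_
        · linarith [abs_nonneg M]
        · exact Real.rpow_le_rpow_of_exponent_le ht (by linarith)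
      _ ≤ _ := by gcongr

/-! ### The Meijer kernel as an inverse Mellin transform -/

theorem contourCross_eq (b₁ b₂ : ℝ) : contourCross b₁ b₂ = min b₁ b₂ - 1 / 8 := by
  simp [contourCross]

/-- Here the four parameters sum to `2 - 2γ`, and `min b₁ b₂ ≥ (1 - γ)/2` is exactly what makes the
crossing abscissa win the maximum. The polygonal contour thus degenerates to a single vertical line.
-/
theorem contourEnd_eq (h₁ : (1 - γ) / 2 ≤ b₁) (h₂ : (1 - γ) / 2 ≤ b₂) :
    contourEnd b₁ b₂ (1 - γ - b₁) (1 - γ - b₂) = min b₁ b₂ - 1 / 8 := by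
  rw [contourEnd, contourCross_eq, max_eq_left]
  have := le_min h₁ h₂
  simp
  linarith

theorem meijerIntegrand_eq (x : ℝ) (l : ℂ) :
    meijerIntegrand b₁ b₂ (1 - γ - b₁) (1 - γ - b₂) x l =
      gammaQuot b₁ γ l * gammaQuot b₂ γ l * (x : ℂ) ^ l := by
  rw [meijerIntegrand, gammaQuot, gammaQuot, div_mul_div_comm]
  congr 5 <;> ring

theorem integral_Iic_add_integral_Ioi {F : ℝ → ℂ} (hF : Integrable F) (T : ℝ) :
    (∫ t in Iic (-T), F t) + (∫ t in (-T)..T, F t) + (∫ t in Ioi T, F t) = ∫ t, F t := by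
  rw [← intervalIntegral.integral_Iic_sub_Iic hF.integrableOn hF.integrableOn, add_sub_cancel]
  exact intervalIntegral.integral_Iic_add_Ioi hF.integrableOn hF.integrableOn

/-- The kernel in logarithmic coordinates. -/
theorem gKernel_eq_lineKernel (hγ : 1 ≤ γ) (h₁ : (1 - γ) / 2 ≤ b₁) (h₂ : (1 - γ) / 2 ≤ b₂)
    {x y : ℝ} (hx : 0 < x) (hy : 0 < y) :
    1 / (γ : ℂ) * gKernel b₁ b₂ γ x y = ((x * y) ^ (-(1 / 2) : ℝ) : ℝ) *
      lineKernel (gSymbol b₁ b₂ γ) (gAbscissa b₁ b₂ γ) (Real.log (x * y)) := by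
  have hxy : 0 < x * y := mul_pos hx hy
  have hγ0 : 0 < γ := by linarith
  have hγc : (γ : ℂ) ≠ 0 := by exact_mod_cast hγ0.ne'
  set L := Real.log (x * y) with hL
  set δ := gAbscissa b₁ b₂ γ
  set c := min b₁ b₂ - 1 / 8 with hc
  set F : ℝ → ℂ := fun t => meijerIntegrand b₁ b₂ (1 - γ - b₁) (1 - γ - b₂)
    ((x * y) ^ (1 / γ)) (c + t * Complex.I) with hF
  -- With `λ = γ(z - 1/2)` the power `((xy)^{1/γ})^λ` is `(xy)^{z - 1/2}`, whence the factor
  -- `(xy)^{-1/2}`.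
  have hFs : ∀ s : ℝ, F (γ * s) = gSymbol b₁ b₂ γ (δ + s * Complex.I) *
      Complex.exp ((δ + s * Complex.I) * L) * ((x * y) ^ (-(1 / 2) : ℝ) : ℝ) := by
    intro s
    rw [hF, gSymbol_line, mul_gAbscissa hγ]
    simp only [meijerIntegrand_eq]
    rw [mul_assoc (_ * _) (Complex.exp _)]
    congr 1
    rw [Complex.cpow_def_of_ne_zero (by exact_mod_cast (Real.rpow_pos_of_pos hxy _).ne'),
      ← Complex.ofReal_log (Real.rpow_pos_of_pos hxy _).le, Real.log_rpow hxy,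
      Real.rpow_def_of_pos hxy, Complex.ofReal_exp, ← Complex.exp_add]
    congr 1
    have hδ : (c : ℂ) = γ * (δ - 1 / 2) := by
      rw [hc, ← mul_gAbscissa (b₁ := b₁) (b₂ := b₂) hγ]; push_cast; rfl
    rw [hδ]
    push_cast
    field_simp
    ring
  have hint : Integrable F := by
    have h1 : Integrable fun s : ℝ => F (γ * s) := by
      simp only [hFs]
      refine Integrable.mul_const ?_ _
      refine (integrable_gSymbol hγ h₁ h₂).mul_bdd (c := Real.exp (δ * L)) ?_ ?_
      · exact Continuous.aestronglyMeasurable (by fun_prop)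
      · refine Eventually.of_forall fun s => ?_
        rw [Complex.norm_exp]
        simp
    exact (integrable_comp_mul_left_iff F hγ0.ne').1 h1
  have hG : gKernel b₁ b₂ γ x y = 1 / (2 * Real.pi) * ∫ t, F t := by
    rw [gKernel, meijerG2004]
    simp only [contourEnd_eq h₁ h₂, contourCross_eq, ← hc, intervalIntegral.integral_same,
      add_zero]
    rw [← integral_Iic_add_integral_Ioi hint (contourHeight b₁ b₂)]
    have : (Real.pi : ℂ) ≠ 0 := by exact_mod_cast Real.pi_ne_zero
    set T := contourHeight b₁ b₂
    change 1 / (2 * Real.pi * Complex.I) * (Complex.I * (∫ t in Iic (-T), F t) +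
      Complex.I * (∫ t in (-T)..T, F t) + Complex.I * ∫ t in Ioi T, F t) = _
    field_simp
  have hsub := Measure.integral_comp_mul_left F γ
  rw [abs_of_pos (inv_pos.2 hγ0), Complex.real_smul, Complex.ofReal_inv] at hsub
  rw [hG, lineKernel, mul_left_comm, one_div (γ : ℂ), ← hsub]
  simp only [hFs]
  rw [integral_mul_const]
  ring

end

/-! ### Kernels on `(0, ∞)` in logarithmic coordinates -/

theorem continuous_lineKernel {m : ℂ → ℂ} {δ : ℝ}
    (hint : Integrable fun t : ℝ => m (δ + t * Complex.I)) : Continuous (lineKernel m δ) := by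
  have h : lineKernel m δ = fun v : ℝ => 1 / (2 * Real.pi) * (Complex.exp (δ * v) *
      ∫ t : ℝ, m (δ + t * Complex.I) * Complex.exp ((t * v : ℝ) * Complex.I)) := by
    ext v
    rw [lineKernel, ← integral_const_mul (Complex.exp (δ * v))]
    congr 2 with t
    rw [add_mul, Complex.exp_add, mul_left_comm]
    congr 3
    push_cast
    ring
  rw [h]
  refine continuous_const.mul ((by fun_prop : Continuous fun v : ℝ => Complex.exp (δ * v)).mul ?_)
  refine continuous_of_dominated (bound := fun t => ‖m (δ + t * Complex.I)‖) ?_ ?_ hint.norm ?_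
  · intro v
    exact hint.aestronglyMeasurable.mul (Continuous.aestronglyMeasurable (by fun_prop))
  · intro v
    refine Eventually.of_forall fun t => ?_
    rw [norm_mul, Complex.norm_exp_ofReal_mul_I, mul_one]
  · exact Eventually.of_forall fun t => by fun_prop

theorem norm_lineKernel_le (m : ℂ → ℂ) (δ v : ℝ) :
    ‖lineKernel m δ v‖ ≤
      (1 / (2 * Real.pi) * ∫ t : ℝ, ‖m (δ + t * Complex.I)‖) * Real.exp (δ * v) := by
  have hpi : ‖(1 / (2 * Real.pi) : ℂ)‖ = 1 / (2 * Real.pi) := by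
    simp [abs_of_pos Real.pi_pos]
  rw [lineKernel, norm_mul, hpi, mul_assoc]
  gcongr
  refine (norm_integral_le_integral_norm _).trans (le_of_eq ?_)
  rw [← integral_mul_const]
  congr with t
  rw [norm_mul, Complex.norm_exp]
  simp

/-- Conjugating the integrand amounts to `t ↦ -t`. The resulting realness of the kernel is what
later makes the operator self-adjoint. -/
theorem conj_lineKernel {m : ℂ → ℂ} (hm : ∀ z, m (conj z) = conj (m z)) (δ v : ℝ) :
    conj (lineKernel m δ v) = lineKernel m δ v := by
  have h2 : conj (2 : ℂ) = 2 := map_ofNat _ 2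
  rw [lineKernel, map_mul, ← integral_conj]
  congr 1
  · simp [h2]
  rw [← integral_neg_eq_self]
  congr with t
  rw [map_mul, ← hm, ← Complex.exp_conj]
  simp

/-- Substitution `x = e^v`. -/
theorem integral_Ioi_eq_integral_exp (g : ℝ → ℂ) :
    ∫ y in Ioi 0, g y = ∫ u : ℝ, Real.exp u • g (Real.exp u) := by
  have h := integral_image_eq_integral_abs_deriv_smul (f := Real.exp) (f' := Real.exp)
    MeasurableSet.univ (fun x _ => (Real.hasDerivAt_exp x).hasDerivWithinAt)
    Real.exp_injective.injOn g
  rw [image_univ, Real.range_exp] at h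
  simpa using h

/-- The map `F ↦ e^{v/2} F(e^v)` is isometric from `L²(ℝ₊)` to `L²(ℝ)`. -/
theorem eLpNorm_comp_exp (F : ℝ → ℂ) :
    eLpNorm F 2 (volume.restrict (Ioi 0)) =
      eLpNorm (fun v : ℝ => (Real.exp (v / 2) : ℂ) * F (Real.exp v)) 2 volume := by
  have h := lintegral_image_eq_lintegral_abs_deriv_mul (f := Real.exp) (f' := Real.exp)
    MeasurableSet.univ (fun x _ => (Real.hasDerivAt_exp x).hasDerivWithinAt)
    Real.exp_injective.injOn (fun x => ‖F x‖ₑ ^ (2 : ℝ))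
  rw [image_univ, Real.range_exp] at h
  simp only [Measure.restrict_univ] at h
  rw [eLpNorm_eq_lintegral_rpow_enorm_toReal two_ne_zero ENNReal.ofNat_ne_top,
    eLpNorm_eq_lintegral_rpow_enorm_toReal two_ne_zero ENNReal.ofNat_ne_top]
  simp only [ENNReal.toReal_ofNat]
  rw [h]
  congr 2 with v
  rw [enorm_mul, ENNReal.mul_rpow_of_nonneg _ _ zero_le_two]
  congr 1
  have e : ‖(Real.exp (v / 2) : ℂ)‖ₑ = ENNReal.ofReal (Real.exp (v / 2)) := by
    rw [← ofReal_norm, Complex.norm_real, Real.norm_eq_abs, Real.abs_exp]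
  rw [e, ENNReal.ofReal_rpow_of_pos (Real.exp_pos _), Real.abs_exp, ← Real.exp_mul]
  congr 2
  ring

/-- Smooth functions with compact support contained in `(0, ∞)`. -/
def posTestFun : Submodule ℂ (ℝ → ℂ) where
  carrier := {f | ContDiff ℝ ∞ f ∧ HasCompactSupport f ∧ tsupport f ⊆ Ioi 0}
  add_mem' := by
    rintro f g ⟨hf1, hf2, hf3⟩ ⟨hg1, hg2, hg3⟩
    exact ⟨hf1.add hg1, hf2.add hg2, (tsupport_add f g).trans (union_subset hf3 hg3)⟩
  zero_mem' := ⟨contDiff_const, HasCompactSupport.zero, by simp⟩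
  smul_mem' := by
    rintro c f ⟨hf1, hf2, hf3⟩
    exact ⟨hf1.const_smul c, hf2.smul_left (f := fun _ => c),
      (tsupport_smul_subset_right (fun _ => c) f).trans hf3⟩

theorem contDiff_posTestFun_comp_exp {f : ℝ → ℂ} (hf : f ∈ posTestFun) :
    ContDiff ℝ ∞ (fun v : ℝ => (Real.exp (v / 2) : ℂ) * f (Real.exp v)) := by
  have h1 : ContDiff ℝ ∞ fun v : ℝ => (Real.exp (v / 2) : ℂ) :=
    Complex.ofRealCLM.contDiff.comp (Real.contDiff_exp.comp (contDiff_id.div_const 2))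
  exact h1.mul (hf.1.comp Real.contDiff_exp)

theorem hasCompactSupport_posTestFun_comp_exp {f : ℝ → ℂ} (hf : f ∈ posTestFun) :
    HasCompactSupport (fun v : ℝ => (Real.exp (v / 2) : ℂ) * f (Real.exp v)) := by
  have hK : IsCompact (Real.log '' tsupport f) := hf.2.1.isCompact.image_of_continuousOn
    (Real.continuousOn_log.mono fun x hx => (hf.2.2 hx).ne')
  refine HasCompactSupport.intro hK fun v hv => ?_
  have : f (Real.exp v) = 0 := by
    refine image_eq_zero_of_notMem_tsupport fun h => hv ?_
    exact ⟨Real.exp v, h, Real.log_exp v⟩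
  simp [this]

/-- The integral operator on `(0, ∞)` with kernel `κ(xy)`. -/
def kernelOp (κ f : ℝ → ℂ) (x : ℝ) : ℂ := ∫ y in Ioi 0, κ (x * y) * f y

/-- A kernel `κ(xy)` on `(0, ∞)` which is real, of size `O(u^a)` with `a > -1/2`, and isometric on
test functions. -/
structure IsIsometricKernel (κ : ℝ → ℂ) (C a : ℝ) : Prop where
  measurable : Measurable κ
  norm_le : ∀ u > 0, ‖κ u‖ ≤ C * u ^ a
  lt_exponent : -(1 / 2) < a
  conj_eq : ∀ u, conj (κ u) = κ u
  isometric : ∀ f ∈ posTestFun, eLpNorm (kernelOp κ f) 2 (volume.restrict (Ioi 0)) =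
    eLpNorm f 2 (volume.restrict (Ioi 0))

/-- The kernel on `(0, ∞)` whose Mellin multiplier is `m`. -/
def mellinKernel (m : ℂ → ℂ) (δ u : ℝ) : ℂ :=
  (u ^ (-(1 / 2) : ℝ) : ℝ) * lineKernel m δ (Real.log u)

/-- With `x = e^v`, `y = e^u` and the half-density factors `e^{v/2}`, `e^{u/2}`, the kernel `κ(xy)`
becomes `k(v + u)`, so the isometry is that of the Fourier multiplier. Absolute convergence on `Re z
= δ` gives the power bound, and `δ > 0` the exponent above `-1/2`. -/
theorem isIsometricKernel_mellinKernel {m : ℂ → ℂ} {δ B : ℝ} (hδ : 0 < δ)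
    (hm : ∀ z : ℂ, z.re ∈ Icc 0 δ → DifferentiableAt ℂ m z)
    (hB : ∀ x ∈ Icc 0 δ, ∀ t : ℝ, 1 ≤ |t| → ‖m (x + t * Complex.I)‖ ≤ B)
    (hone : ∀ t : ℝ, ‖m (t * Complex.I)‖ = 1)
    (hint : Integrable fun t : ℝ => m (δ + t * Complex.I))
    (hconj : ∀ z, m (conj z) = conj (m z)) :
    IsIsometricKernel (mellinKernel m δ)
      (1 / (2 * Real.pi) * ∫ t : ℝ, ‖m (δ + t * Complex.I)‖) (δ - 1 / 2) where
  measurable := by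
    refine Measurable.mul ?_ ((continuous_lineKernel hint).measurable.comp Real.measurable_log)
    exact Complex.measurable_ofReal.comp (measurable_id.pow_const _)
  norm_le := by
    intro u hu
    have h := norm_lineKernel_le m δ (Real.log u)
    rw [mul_comm δ, ← Real.rpow_def_of_pos hu] at h
    have hp : 0 < u ^ (-(1 / 2) : ℝ) := Real.rpow_pos_of_pos hu _
    rw [mellinKernel, norm_mul, Complex.norm_real, Real.norm_of_nonneg hp.le]
    have e : δ - 1 / 2 = -(1 / 2) + δ := by ring
    rw [e, Real.rpow_add hu, mul_left_comm]
    gcongr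
  lt_exponent := by linarith
  conj_eq := by
    intro u
    rw [mellinKernel, map_mul, conj_lineKernel hconj, Complex.conj_ofReal]
  isometric := by
    intro f hf
    rw [eLpNorm_comp_exp, eLpNorm_comp_exp f,
      ← eLpNorm_lineKernel_integral hδ.le hm hB hone hint (contDiff_posTestFun_comp_exp hf)
        (hasCompactSupport_posTestFun_comp_exp hf)]
    congr with v
    rw [kernelOp, integral_Ioi_eq_integral_exp, ← integral_const_mul]
    congr with u
    rw [mellinKernel, ← Real.exp_add, Real.log_exp, Real.rpow_def_of_pos (Real.exp_pos _),
      Real.log_exp, Complex.real_smul]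
    have e : Real.exp u = Real.exp (u / 2) * Real.exp (u / 2) := by
      rw [← Real.exp_add]; congr 1; ring
    have e2 : Real.exp ((v + u) * -(1 / 2)) * Real.exp (v / 2) * Real.exp (u / 2) = 1 := by
      rw [← Real.exp_add, ← Real.exp_add, Real.exp_eq_one_iff]; ring
    have hexp_one : (Real.exp ((v + u) * -(1 / 2)) : ℂ) * Real.exp (v / 2) * Real.exp (u / 2) = 1 := by
      exact_mod_cast e2
    have hexp_sq : (Real.exp u : ℂ) = Real.exp (u / 2) * Real.exp (u / 2) := by exact_mod_cast e
    rw [hexp_sq]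
    linear_combination (lineKernel m δ (v + u) * Real.exp (u / 2) * f (Real.exp u)) * hexp_one

/-! ### Absolute convergence and symmetry of the integral operator -/

/-- Integrability against the weight `y ^ a` on `(0, ∞)`. -/
def WeightedIntegrable (a : ℝ) (f : ℝ → ℂ) : Prop :=
  Integrable (fun y => ((y ^ a : ℝ) : ℂ) * f y) (volume.restrict (Ioi 0))

theorem WeightedIntegrable.aestronglyMeasurable {a : ℝ} {f : ℝ → ℂ} (hf : WeightedIntegrable a f) :
    AEStronglyMeasurable f (volume.restrict (Ioi 0)) := by
  have h1 : AEStronglyMeasurable (fun y : ℝ => ((y ^ (-a) : ℝ) : ℂ))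
      (volume.restrict (Ioi 0)) :=
    (Complex.measurable_ofReal.comp (measurable_id.pow_const _)).aestronglyMeasurable
  refine (h1.mul hf.1).congr ?_
  filter_upwards [ae_restrict_mem measurableSet_Ioi] with y hy
  have : ((y ^ (-a) : ℝ) : ℂ) * ((y ^ a : ℝ) : ℂ) = 1 := by
    rw [← Complex.ofReal_mul, ← Real.rpow_add hy]; simp
  simp only [Pi.mul_apply]
  rw [← mul_assoc, this, one_mul]

theorem WeightedIntegrable.congr_ae {a : ℝ} {f g : ℝ → ℂ} (hf : WeightedIntegrable a f)
    (h : f =ᵐ[volume.restrict (Ioi 0)] g) : WeightedIntegrable a g :=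
  hf.congr (h.mono fun y hy => by simp only [hy])

theorem WeightedIntegrable.conj {a : ℝ} {f : ℝ → ℂ} (hf : WeightedIntegrable a f) :
    WeightedIntegrable a (fun y => conj (f y)) := by
  refine hf.congr' ?_ (Eventually.of_forall fun y => ?_)
  · exact (Complex.measurable_ofReal.comp (measurable_id.pow_const _)).aestronglyMeasurable.mul
      (Complex.continuous_conj.comp_aestronglyMeasurable hf.aestronglyMeasurable)
  · simp

theorem weightedIntegrable_of_posTestFun (a : ℝ) {f : ℝ → ℂ} (hf : f ∈ posTestFun) :
    WeightedIntegrable a f := by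
  refine Integrable.integrableOn ?_
  have hc : Continuous fun y : ℝ => ((y ^ a : ℝ) : ℂ) * f y := by
    refine continuous_iff_continuousAt.2 fun y => ?_
    by_cases hy : y ∈ tsupport f
    · refine ContinuousAt.mul ?_ hf.1.continuous.continuousAt
      exact Complex.continuous_ofReal.continuousAt.comp
        (Real.continuousAt_rpow_const y a (Or.inl (hf.2.2 hy).ne'))
    · have h0 : (fun y : ℝ => ((y ^ a : ℝ) : ℂ) * f y) =ᶠ[𝓝 y] fun _ => 0 := by
        filter_upwards [notMem_tsupport_iff_eventuallyEq.1 hy] with z hz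
        simp [hz]
      exact continuousAt_const.congr h0.symm
  exact hc.integrable_of_hasCompactSupport hf.2.1.mul_left

theorem memLp_posTestFun {f : ℝ → ℂ} (hf : f ∈ posTestFun) :
    MemLp f 2 (volume.restrict (Ioi 0)) :=
  (hf.1.continuous.memLp_of_hasCompactSupport hf.2.1).restrict _

/-- `a > -1/2` is the condition for `y^{2a}` to be integrable at `0`. -/
theorem memLp_rpow_Ioc {a : ℝ} (ha : -(1 / 2) < a) (R : ℝ) :
    MemLp (fun y : ℝ => ((y ^ a : ℝ) : ℂ)) 2 (volume.restrict (Ioc 0 R)) := by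
  have hm : AEStronglyMeasurable (fun y : ℝ => ((y ^ a : ℝ) : ℂ)) (volume.restrict (Ioc 0 R)) :=
    (Complex.measurable_ofReal.comp (measurable_id.pow_const _)).aestronglyMeasurable
  rw [memLp_two_iff_integrable_sq_norm hm]
  rcases le_total R 0 with hR | hR
  · simp [Ioc_eq_empty_of_le hR]
  have h := intervalIntegral.intervalIntegrable_rpow' (a := 0) (b := R)
    (show -1 < a + a by linarith)
  rw [intervalIntegrable_iff_integrableOn_Ioc_of_le hR] at h
  refine h.congr_fun (fun y hy => ?_) measurableSet_Ioc
  simp only [Complex.norm_real, Real.norm_eq_abs, sq_abs]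
  rw [Real.rpow_add hy.1, sq]

/-- By Hölder, since `y^a` is square integrable on `(0, R]`. Hence every truncation of an `L²`
function is admissible for the integral operator. -/
theorem weightedIntegrable_indicator_Ioc {a : ℝ} (ha : -(1 / 2) < a) {f : ℝ → ℂ}
    (hf : MemLp f 2 (volume.restrict (Ioi 0))) (R : ℝ) :
    WeightedIntegrable a ((Ioc 0 R).indicator f) := by
  have h1 : MemLp f 2 (volume.restrict (Ioc 0 R)) :=
    hf.mono_measure (Measure.restrict_mono Ioc_subset_Ioi_self le_rfl)
  have h2 : IntegrableOn (fun y => ((y ^ a : ℝ) : ℂ) * f y) (Ioc 0 R) :=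
    (memLp_rpow_Ioc ha R).integrable_mul h1
  have h3 : (fun y => ((y ^ a : ℝ) : ℂ) * (Ioc 0 R).indicator f y) =
      (Ioc 0 R).indicator fun y => ((y ^ a : ℝ) : ℂ) * f y := by
    ext y
    by_cases hy : y ∈ Ioc 0 R <;> simp [hy]
  rw [WeightedIntegrable, h3]
  exact (integrable_indicator_iff measurableSet_Ioc).2 h2 |>.integrableOn

theorem kernelOp_congr_ae {κ f g : ℝ → ℂ} (h : f =ᵐ[volume.restrict (Ioi 0)] g) :
    kernelOp κ f = kernelOp κ g := by
  ext x
  exact integral_congr_ae (h.mono fun y hy => by simp only [hy])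

theorem kernelOp_indicator (κ f : ℝ → ℂ) (R x : ℝ) :
    kernelOp κ ((Ioc 0 R).indicator f) x = ∫ y in Ioc 0 R, κ (x * y) * f y := by
  have h : (fun y => κ (x * y) * (Ioc 0 R).indicator f y) =
      (Ioc 0 R).indicator fun y => κ (x * y) * f y := by
    ext y
    by_cases hy : y ∈ Ioc 0 R <;> simp [hy]
  rw [kernelOp, h, setIntegral_indicator measurableSet_Ioc,
    inter_eq_right.2 Ioc_subset_Ioi_self]

namespace IsIsometricKernel

variable {κ : ℝ → ℂ} {C a : ℝ}

theorem norm_mul_le (hκ : IsIsometricKernel κ C a) {x y : ℝ} (hx : 0 < x) (hy : 0 < y) (z : ℂ) :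
    ‖κ (x * y) * z‖ ≤ C * x ^ a * ‖((y ^ a : ℝ) : ℂ) * z‖ := by
  have h := hκ.norm_le (x * y) (mul_pos hx hy)
  rw [norm_mul, norm_mul, Complex.norm_real, Real.norm_of_nonneg (Real.rpow_nonneg hy.le _),
    ← mul_assoc]
  rw [Real.mul_rpow hx.le hy.le, ← mul_assoc] at h
  gcongr

theorem integrable (hκ : IsIsometricKernel κ C a) {f : ℝ → ℂ}
    (hf : WeightedIntegrable a f) {x : ℝ} (hx : 0 < x) :
    IntegrableOn (fun y => κ (x * y) * f y) (Ioi 0) := by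
  refine (hf.norm.const_mul (C * x ^ a)).mono' ?_ ?_
  · exact (hκ.measurable.comp (measurable_const_mul x)).aestronglyMeasurable.mul
      hf.aestronglyMeasurable
  · filter_upwards [ae_restrict_mem measurableSet_Ioi] with y hy
    exact hκ.norm_mul_le hx hy _

theorem norm_kernelOp_le (hκ : IsIsometricKernel κ C a) {f : ℝ → ℂ}
    (hf : WeightedIntegrable a f) {x : ℝ} (hx : 0 < x) :
    ‖kernelOp κ f x‖ ≤ C * x ^ a * ∫ y in Ioi 0, ‖((y ^ a : ℝ) : ℂ) * f y‖ := by
  rw [← integral_const_mul]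
  refine norm_integral_le_of_norm_le (hf.norm.const_mul _) ?_
  filter_upwards [ae_restrict_mem measurableSet_Ioi] with y hy
  exact hκ.norm_mul_le hx hy _

theorem aestronglyMeasurable_kernelOp (hκ : IsIsometricKernel κ C a) {f : ℝ → ℂ}
    (hf : AEStronglyMeasurable f (volume.restrict (Ioi 0))) :
    AEStronglyMeasurable (kernelOp κ f) (volume.restrict (Ioi 0)) := by
  have h1 : AEStronglyMeasurable (fun p : ℝ × ℝ => κ (p.1 * p.2) * f p.2)
      ((volume.restrict (Ioi 0)).prod (volume.restrict (Ioi 0))) :=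
    (hκ.measurable.comp (measurable_fst.mul measurable_snd)).aestronglyMeasurable.mul hf.comp_snd
  exact h1.integral_prod_right'

/-- The pointwise bound is a multiple of `x^a`, continuous on `(0, ∞)`. Local integrability lets
functions be compared by integrating against test functions. -/
theorem locallyIntegrableOn_kernelOp (hκ : IsIsometricKernel κ C a) {f : ℝ → ℂ}
    (hf : WeightedIntegrable a f) :
    LocallyIntegrableOn (kernelOp κ f) (Ioi 0) := by
  set I := ∫ y in Ioi 0, ‖((y ^ a : ℝ) : ℂ) * f y‖
  have h1 : LocallyIntegrableOn (fun x : ℝ => C * x ^ a * I) (Ioi 0) := by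
    refine ContinuousOn.locallyIntegrableOn ?_ measurableSet_Ioi
    refine (continuousOn_const.mul ?_).mul continuousOn_const
    exact fun x hx => (Real.continuousAt_rpow_const x a (Or.inl (ne_of_gt hx))).continuousWithinAt
  refine (locallyIntegrableOn_iff isOpen_Ioi.isLocallyClosed).2 fun K hK hKc => ?_
  refine Integrable.mono' (h1.integrableOn_compact_subset hK hKc)
    ((hκ.aestronglyMeasurable_kernelOp hf.aestronglyMeasurable).mono_measure
      (Measure.restrict_mono hK le_rfl)) ?_
  filter_upwards [ae_restrict_mem hKc.measurableSet] with x hx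
  exact hκ.norm_kernelOp_le hf (hK hx)

/-- The operator with kernel `κ(xy)` is symmetric for the bilinear pairing. -/
theorem integral_kernelOp_mul (hκ : IsIsometricKernel κ C a) {f h : ℝ → ℂ}
    (hf : WeightedIntegrable a f)
    (hh : WeightedIntegrable a h) :
    ∫ x in Ioi 0, kernelOp κ h x * f x = ∫ y in Ioi 0, h y * kernelOp κ f y := by
  have hprod : Integrable (Function.uncurry fun x y : ℝ => κ (x * y) * h y * f x)
      ((volume.restrict (Ioi 0)).prod (volume.restrict (Ioi 0))) := by
    refine ((Integrable.mul_prod hf hh).norm.const_mul C).mono' ?_ ?_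
    · exact ((hκ.measurable.comp (measurable_fst.mul measurable_snd)).aestronglyMeasurable.mul
        hh.aestronglyMeasurable.comp_snd).mul hf.aestronglyMeasurable.comp_fst
    · have h0 : ∀ᵐ p : ℝ × ℝ ∂((volume.restrict (Ioi 0)).prod (volume.restrict (Ioi 0))),
          p.1 ∈ Ioi 0 ∧ p.2 ∈ Ioi 0 := by
        rw [Measure.prod_restrict]
        exact ae_restrict_mem (measurableSet_Ioi.prod measurableSet_Ioi)
      filter_upwards [h0] with p hp
      have h1 := hκ.norm_mul_le hp.1 hp.2 (h p.2)
      simp only [Function.uncurry]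
      rw [norm_mul]
      calc _ ≤ C * p.1 ^ a * ‖((p.2 ^ a : ℝ) : ℂ) * h p.2‖ * ‖f p.1‖ := by gcongr
        _ = _ := by
          rw [norm_mul (_ * f p.1), norm_mul _ (f p.1), Complex.norm_real,
            Real.norm_of_nonneg (Real.rpow_nonneg (le_of_lt hp.1) _)]
          ring
  calc ∫ x in Ioi 0, kernelOp κ h x * f x
      = ∫ x in Ioi 0, ∫ y in Ioi 0, κ (x * y) * h y * f x := by
        congr with x
        rw [integral_mul_const, kernelOp]
    _ = ∫ y in Ioi 0, ∫ x in Ioi 0, κ (x * y) * h y * f x := integral_integral_swap hprod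
    _ = _ := by
        congr with y
        rw [kernelOp, ← integral_const_mul]
        congr with x
        rw [mul_comm x y]
        ring

theorem conj_kernelOp (hκ : IsIsometricKernel κ C a) (f : ℝ → ℂ) (x : ℝ) :
    conj (kernelOp κ f x) = kernelOp κ (fun y => conj (f y)) x := by
  rw [kernelOp, ← integral_conj]
  congr with y
  rw [map_mul, hκ.conj_eq]

theorem memLp_kernelOp (hκ : IsIsometricKernel κ C a) {f : ℝ → ℂ} (hf : f ∈ posTestFun) :
    MemLp (kernelOp κ f) 2 (volume.restrict (Ioi 0)) :=
  ⟨hκ.aestronglyMeasurable_kernelOp (memLp_posTestFun hf).1, by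
    rw [hκ.isometric f hf]
    exact (memLp_posTestFun hf).2⟩

end IsIsometricKernel

/-! ### Extension to a self-adjoint unitary on `L²(ℝ₊)` -/

/-- Test functions as elements of `L²(ℝ₊)`. -/
def posTestFunToLp : posTestFun →ₗ[ℂ] L2Pos where
  toFun f := (memLp_posTestFun f.2).toLp f
  map_add' _ _ := rfl
  map_smul' _ _ := rfl

theorem coeFn_posTestFunToLp (f : posTestFun) :
    posTestFunToLp f =ᵐ[volume.restrict (Ioi 0)] (f : ℝ → ℂ) :=
  (memLp_posTestFun f.2).coeFn_toLp

theorem ofReal_mem_posTestFun {g : ℝ → ℝ} (hg1 : ContDiff ℝ ∞ g) (hg2 : HasCompactSupport g)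
    (hg3 : tsupport g ⊆ Ioi 0) : (fun x => (g x : ℂ)) ∈ posTestFun :=
  ⟨Complex.ofRealCLM.contDiff.comp hg1, hg2.comp_left (g := Complex.ofReal) rfl,
    (tsupport_comp_subset (g := Complex.ofReal) rfl g).trans hg3⟩

theorem inner_eq_integral (f g : L2Pos) :
    inner ℂ f g = ∫ x in Ioi 0, conj (f x) * g x := by
  rw [L2.inner_def]
  congr with x
  rw [RCLike.inner_apply, mul_comm]

theorem integral_smul_eq_setIntegral {g : ℝ → ℝ} (hg : tsupport g ⊆ Ioi 0) (f : ℝ → ℂ) :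
    ∫ x, g x • f x = ∫ x in Ioi 0, (g x : ℂ) * f x := by
  rw [← setIntegral_eq_integral_of_forall_compl_eq_zero (s := Ioi 0)]
  · simp
  · intro x hx
    have : g x = 0 := image_eq_zero_of_notMem_tsupport fun h => hx (hg h)
    simp [this]

theorem locallyIntegrableOn_L2Pos (f : L2Pos) : LocallyIntegrableOn f (Ioi 0) :=
  locallyIntegrableOn_of_locallyIntegrable_restrict ((Lp.memLp f).locallyIntegrable one_le_two)

/-- A function orthogonal to all real test functions supported in `(0, ∞)` vanishes almost
everywhere there. -/
theorem denseRange_posTestFunToLp : DenseRange posTestFunToLp := by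
  have h : (LinearMap.range posTestFunToLp).topologicalClosure = ⊤ := by
    rw [Submodule.topologicalClosure_eq_top_iff, Submodule.eq_bot_iff]
    intro f hf
    rw [Submodule.mem_orthogonal] at hf
    have h0 := isOpen_Ioi.ae_eq_zero_of_integral_contDiff_smul_eq_zero
      (locallyIntegrableOn_L2Pos f) (fun g hg1 hg2 hg3 => ?_)
    · rw [Lp.eq_zero_iff_ae_eq_zero]
      exact (ae_restrict_iff' measurableSet_Ioi).2 h0
    · have h1 := hf _ (LinearMap.mem_range_self posTestFunToLp
        ⟨_, ofReal_mem_posTestFun hg1 hg2 hg3⟩)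
      rw [inner_eq_integral] at h1
      rw [integral_smul_eq_setIntegral hg3, ← h1]
      refine integral_congr_ae ?_
      filter_upwards [coeFn_posTestFunToLp ⟨_, ofReal_mem_posTestFun hg1 hg2 hg3⟩] with x hx
      rw [hx, Complex.conj_ofReal]
  have h2 := Submodule.dense_iff_topologicalClosure_eq_top.2 h
  rwa [LinearMap.coe_range] at h2

theorem integrable_smul_of_locallyIntegrableOn {s : Set ℝ} {f : ℝ → ℂ} {g : ℝ → ℝ}
    (hf : LocallyIntegrableOn f s) (hg : Continuous g) (hc : HasCompactSupport g)
    (hs : tsupport g ⊆ s) : Integrable fun x => g x • f x := by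
  have h : IntegrableOn (fun x => g x • f x) (tsupport g) :=
    (hf.integrableOn_compact_subset hs hc).continuousOn_smul hg.continuousOn hc
  refine (integrableOn_iff_integrable_of_support_subset ?_).1 h
  exact (Function.support_smul_subset_left _ _).trans (subset_tsupport g)

namespace IsIsometricKernel

variable {κ : ℝ → ℂ} {C a : ℝ} (hκ : IsIsometricKernel κ C a)

/-- The integral operator with kernel `κ(xy)` on test functions. -/
def testOp : posTestFun →ₗ[ℂ] L2Pos where
  toFun f := (hκ.memLp_kernelOp f.2).toLp _
  map_add' f g := by
    rw [← MemLp.toLp_add]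
    refine MemLp.toLp_congr _ _ ?_
    filter_upwards [ae_restrict_mem measurableSet_Ioi] with x hx
    simp only [Pi.add_apply, Submodule.coe_add, kernelOp, mul_add]
    exact integral_add (hκ.integrable (weightedIntegrable_of_posTestFun a f.2) hx)
      (hκ.integrable (weightedIntegrable_of_posTestFun a g.2) hx)
  map_smul' c f := by
    rw [RingHom.id_apply, ← MemLp.toLp_const_smul]
    refine MemLp.toLp_congr _ _ (Eventually.of_forall fun x => ?_)
    simp only [Pi.smul_apply, Submodule.coe_smul, kernelOp, smul_eq_mul]
    rw [← integral_const_mul]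
    congr with y
    ring

theorem coeFn_testOp (f : posTestFun) :
    hκ.testOp f =ᵐ[volume.restrict (Ioi 0)] kernelOp κ f :=
  (hκ.memLp_kernelOp f.2).coeFn_toLp

theorem norm_testOp (f : posTestFun) : ‖hκ.testOp f‖ = ‖posTestFunToLp f‖ := by
  rw [Lp.norm_def, Lp.norm_def, eLpNorm_congr_ae (hκ.coeFn_testOp f),
    eLpNorm_congr_ae (coeFn_posTestFunToLp f), hκ.isometric _ f.2]

/-- The extension of the integral operator with kernel `κ(xy)` to `L²(ℝ₊)`. -/
def extendedOp : L2Pos →L[ℂ] L2Pos := hκ.testOp.extendOfNorm posTestFunToLp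

theorem extendedOp_posTestFun (f : posTestFun) :
    hκ.extendedOp (posTestFunToLp f) = hκ.testOp f :=
  LinearMap.extendOfNorm_eq denseRange_posTestFunToLp
    ⟨1, fun x => by rw [one_mul, hκ.norm_testOp]⟩ f

theorem norm_extendedOp (f : L2Pos) : ‖hκ.extendedOp f‖ = ‖f‖ := by
  refine denseRange_posTestFunToLp.induction_on (p := fun f => ‖hκ.extendedOp f‖ = ‖f‖) f
    (isClosed_eq (by fun_prop) (by fun_prop)) fun h => ?_
  rw [hκ.extendedOp_posTestFun, hκ.norm_testOp]

/-- As `κ` is real, the bilinear symmetry `integral_kernelOp_mul` becomes symmetry for the inner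
product. Here `f` need only be weighted integrable, beyond lying in `L²`. -/
theorem inner_testOp_left (h : posTestFun) {f : L2Pos} (hf : WeightedIntegrable a f) :
    inner ℂ (hκ.testOp h) f = ∫ x in Ioi 0, conj ((h : ℝ → ℂ) x) * kernelOp κ f x := by
  rw [inner_eq_integral,
    ← hκ.integral_kernelOp_mul hf (weightedIntegrable_of_posTestFun a h.2).conj]
  refine integral_congr_ae ?_
  filter_upwards [hκ.coeFn_testOp h] with x hx
  rw [hx, hκ.conj_kernelOp]

theorem inner_extendedOp_comm (f g : L2Pos) :
    inner ℂ (hκ.extendedOp f) g = inner ℂ f (hκ.extendedOp g) := by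
  refine denseRange_posTestFunToLp.induction_on
    (p := fun f => inner ℂ (hκ.extendedOp f) g = inner ℂ f (hκ.extendedOp g)) f
    (isClosed_eq (by fun_prop) (by fun_prop)) fun h => ?_
  refine denseRange_posTestFunToLp.induction_on
    (p := fun g => inner ℂ (hκ.extendedOp (posTestFunToLp h)) g =
      inner ℂ (posTestFunToLp h) (hκ.extendedOp g)) g
    (isClosed_eq (by fun_prop) (by fun_prop)) fun k => ?_
  rw [hκ.extendedOp_posTestFun, hκ.extendedOp_posTestFun, hκ.inner_testOp_left h
    ((weightedIntegrable_of_posTestFun a k.2).congr_ae (coeFn_posTestFunToLp k).symm),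
    inner_eq_integral]
  refine integral_congr_ae ?_
  filter_upwards [hκ.coeFn_testOp k, coeFn_posTestFunToLp h] with x hx hx'
  rw [hx, hx', kernelOp_congr_ae (coeFn_posTestFunToLp k)]

/-- On functions which are integrable for the weight `y ^ a`, the extension is still given by the
integral. -/
theorem coeFn_extendedOp {f : L2Pos} (hf : WeightedIntegrable a f) :
    hκ.extendedOp f =ᵐ[volume.restrict (Ioi 0)] kernelOp κ f := by
  -- The two locally integrable functions are compared by pairing with a real test function `g`:
  -- self-adjointness moves the extension onto `g`, where it is the integral operator, and Fubini
  -- moves the kernel back onto `f`.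
  have h0 := isOpen_Ioi.ae_eq_zero_of_integral_contDiff_smul_eq_zero
    ((locallyIntegrableOn_L2Pos (hκ.extendedOp f)).sub (hκ.locallyIntegrableOn_kernelOp hf))
    (fun g hg1 hg2 hg3 => ?_)
  · filter_upwards [(ae_restrict_iff' measurableSet_Ioi).2 h0] with x hx
    exact sub_eq_zero.1 hx
  · set G : posTestFun := ⟨_, ofReal_mem_posTestFun hg1 hg2 hg3⟩ with hG
    have hL := integrable_smul_of_locallyIntegrableOn (locallyIntegrableOn_L2Pos (hκ.extendedOp f))
      hg1.continuous hg2 hg3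
    have hR := integrable_smul_of_locallyIntegrableOn (hκ.locallyIntegrableOn_kernelOp hf)
      hg1.continuous hg2 hg3
    have h1 : inner ℂ (posTestFunToLp G) (hκ.extendedOp f) =
        ∫ x in Ioi 0, (g x : ℂ) * hκ.extendedOp f x := by
      rw [inner_eq_integral]
      refine integral_congr_ae ?_
      filter_upwards [coeFn_posTestFunToLp G] with x hx
      rw [hx, hG, Complex.conj_ofReal]
    have h2 := hκ.inner_testOp_left G hf
    rw [← hκ.extendedOp_posTestFun, hκ.inner_extendedOp_comm, h1] at h2
    simp only [Pi.sub_apply, smul_sub]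
    rw [integral_sub hL hR, integral_smul_eq_setIntegral hg3, integral_smul_eq_setIntegral hg3, h2,
      sub_eq_zero]
    simp [hG]

/-- An isometry `U` satisfies `U*U = 1`, and here `U* = U`. -/
theorem extendedOp_extendedOp (f : L2Pos) : hκ.extendedOp (hκ.extendedOp f) = f := by
  let U : L2Pos →ₗᵢ[ℂ] L2Pos := ⟨hκ.extendedOp.toLinearMap, hκ.norm_extendedOp⟩
  refine ext_inner_right ℂ fun g => ?_
  rw [hκ.inner_extendedOp_comm]
  exact U.inner_map_map f g

/-- The unitary operator on `L²(ℝ₊)` with kernel `κ(xy)`. -/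
def unitaryOp : L2Pos ≃ₗᵢ[ℂ] L2Pos where
  toLinearEquiv := LinearEquiv.ofInvolutive hκ.extendedOp.toLinearMap hκ.extendedOp_extendedOp
  norm_map' := hκ.norm_extendedOp

theorem unitaryOp_unitaryOp (f : L2Pos) : hκ.unitaryOp (hκ.unitaryOp f) = f :=
  hκ.extendedOp_extendedOp f

theorem coeFn_unitaryOp {f : L2Pos} (hf : WeightedIntegrable a f) :
    hκ.unitaryOp f =ᵐ[volume.restrict (Ioi 0)] kernelOp κ f :=
  hκ.coeFn_extendedOp hf

end IsIsometricKernel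

/-! ### Truncation, and why the operator is not the identity -/

/-- Multiplication by the indicator function of `(0, R]` on `L²(ℝ₊)`. -/
def truncL2 (R : ℝ) (f : L2Pos) : L2Pos :=
  ((Lp.memLp f).indicator (measurableSet_Ioc (a := 0) (b := R))).toLp _

theorem coeFn_truncL2 (R : ℝ) (f : L2Pos) :
    truncL2 R f =ᵐ[volume.restrict (Ioi 0)] (Ioc 0 R).indicator f :=
  MemLp.coeFn_toLp _

theorem tendsto_eLpNorm_indicator_Ioc_sub {f : ℝ → ℂ}
    (hf : MemLp f 2 (volume.restrict (Ioi 0))) :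
    Tendsto (fun R : ℝ => eLpNorm ((Ioc 0 R).indicator f - f) 2 (volume.restrict (Ioi 0))) atTop
      (𝓝 0) := by
  have h1 : Tendsto (fun R : ℝ => ∫⁻ x in Ioi 0, ‖((Ioc 0 R).indicator f - f) x‖ₑ ^ (2 : ℝ)) atTop
      (𝓝 (∫⁻ _ in Ioi (0 : ℝ), 0)) := by
    refine tendsto_lintegral_filter_of_dominated_convergence' (fun x => ‖f x‖ₑ ^ (2 : ℝ))
      ?_ ?_ ?_ ?_
    · exact Eventually.of_forall fun R =>
        ((hf.1.indicator measurableSet_Ioc).sub hf.1).enorm.pow_const _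
    · refine Eventually.of_forall fun R => Eventually.of_forall fun x => ?_
      by_cases hx : x ∈ Ioc 0 R <;> simp [hx]
    · have := (eLpNorm_lt_top_iff_lintegral_rpow_enorm_lt_top two_ne_zero
        ENNReal.ofNat_ne_top).1 hf.2
      simpa using this.ne
    · filter_upwards [ae_restrict_mem measurableSet_Ioi] with x hx
      refine tendsto_const_nhds.congr' ?_
      filter_upwards [eventually_ge_atTop x] with R hR
      have hm : x ∈ Ioc 0 R := ⟨hx, hR⟩
      simp [hm]
  have h2 := h1.ennrpow_const (1 / 2 : ℝ)
  rw [lintegral_zero, ENNReal.zero_rpow_of_pos (by norm_num)] at h2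
  refine h2.congr fun R => ?_
  rw [eLpNorm_eq_lintegral_rpow_enorm_toReal two_ne_zero ENNReal.ofNat_ne_top]
  simp

theorem setIntegral_Ioc_comp_mul_left (κ : ℝ → ℂ) (x : ℝ) :
    ∫ y in Ioc 0 2, κ (x * y) = 2 * ∫ y in Ioc 0 1, κ (2 * x * y) := by
  have h := intervalIntegral.integral_comp_mul_left (a := 0) (b := 1) (fun y => κ (x * y))
    (c := 2) two_ne_zero
  rw [mul_zero, mul_one, intervalIntegral.integral_of_le zero_le_one,
    intervalIntegral.integral_of_le zero_le_two, Complex.real_smul] at h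
  have e : ∀ y, x * (2 * y) = 2 * x * y := fun y => by ring
  simp only [e] at h
  rw [h]
  push_cast
  ring

theorem quasiMeasurePreserving_two_mul :
    Measure.QuasiMeasurePreserving (fun x : ℝ => 2 * x) volume volume := by
  refine ⟨measurable_const_mul 2, ?_⟩
  rw [Real.map_volume_mul_left two_ne_zero]
  exact Measure.smul_absolutelyContinuous

/-- A kernel in the product `xy` reverses dilations, whereas the identity commutes with them.
Indicators of `(0, 1]` and `(0, 2]` already exhibit the conflict. -/
theorem IsIsometricKernel.unitaryOp_ne_one {κ : ℝ → ℂ} {C a : ℝ} (hκ : IsIsometricKernel κ C a) :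
    hκ.unitaryOp ≠ 1 := by
  intro hS
  have hmem : ∀ R : ℝ, MemLp ((Ioc 0 R).indicator fun _ : ℝ => (1 : ℂ)) 2
      (volume.restrict (Ioi 0)) := fun R =>
    (memLp_indicator_const 2 measurableSet_Ioc (1 : ℂ) (Or.inr (by simp))).restrict _
  have key : ∀ R : ℝ, ∀ᵐ x : ℝ, 0 < x →
      ∫ y in Ioc 0 R, κ (x * y) = (Ioc 0 R).indicator (fun _ : ℝ => (1 : ℂ)) x := by
    intro R
    refine (ae_restrict_iff' measurableSet_Ioi).1 ?_
    have hw : WeightedIntegrable a ((hmem R).toLp _) := by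
      have := weightedIntegrable_indicator_Ioc hκ.lt_exponent (hmem R) R
      rw [indicator_indicator, inter_self] at this
      exact this.congr_ae (hmem R).coeFn_toLp.symm
    have h := hκ.coeFn_unitaryOp hw
    rw [hS, LinearIsometryEquiv.coe_one, id, kernelOp_congr_ae (hmem R).coeFn_toLp] at h
    filter_upwards [h, (hmem R).coeFn_toLp] with x hx hx'
    rw [hx', kernelOp_indicator] at hx
    simpa using hx.symm
  have h1 := quasiMeasurePreserving_two_mul.ae (key 1)
  -- For `0 < x < 1/2`, the integral over `(0, 2]` at `x` would be `1`, but by scaling it is twice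
  -- the integral over `(0, 1]` at `2x`, that is `2`.
  have hnull : ∀ᵐ x : ℝ, x ∉ Ioo (0 : ℝ) (1 / 2) := by
    filter_upwards [h1, key 2] with x hx hx' hmemx
    obtain ⟨h0, hlt⟩ := hmemx
    have e1 := hx (by linarith)
    have e2 := hx' h0
    rw [setIntegral_Ioc_comp_mul_left, e1, indicator_of_mem (by constructor <;> linarith),
      indicator_of_mem (by constructor <;> linarith)] at e2
    norm_num at e2
  simp [ae_iff, Ioo_def] at hnull

/-! ### The `G`-transform -/

section

variable {b₁ b₂ γ : ℝ}

/-- `(1/γ) G((xy)^{1/γ})` as a function of `xy`. -/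
def gProfile (b₁ b₂ γ : ℝ) : ℝ → ℂ := mellinKernel (gSymbol b₁ b₂ γ) (gAbscissa b₁ b₂ γ)

theorem gKernel_eq_gProfile (hγ : 1 ≤ γ) (h₁ : (1 - γ) / 2 ≤ b₁) (h₂ : (1 - γ) / 2 ≤ b₂)
    {x y : ℝ} (hx : 0 < x) (hy : 0 < y) :
    1 / (γ : ℂ) * gKernel b₁ b₂ γ x y = gProfile b₁ b₂ γ (x * y) :=
  gKernel_eq_lineKernel hγ h₁ h₂ hx hy

theorem exists_isIsometricKernel_gProfile (hγ : 1 ≤ γ) (h₁ : (1 - γ) / 2 ≤ b₁)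
    (h₂ : (1 - γ) / 2 ≤ b₂) : ∃ C a, IsIsometricKernel (gProfile b₁ b₂ γ) C a :=
  ⟨_, _, isIsometricKernel_mellinKernel (gAbscissa_pos hγ h₁ h₂)
    (differentiableAt_gSymbol hγ h₁ h₂) (norm_gSymbol_le_const hγ)
    (norm_gSymbol_eq_one h₁ h₂) (integrable_gSymbol hγ h₁ h₂) gSymbol_conj⟩

theorem gKernel_mul_eq (hγ : 1 ≤ γ) (h₁ : (1 - γ) / 2 ≤ b₁) (h₂ : (1 - γ) / 2 ≤ b₂)
    {x y : ℝ} (hx : 0 < x) (hy : 0 < y) (z : ℂ) :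
    gKernel b₁ b₂ γ x y * z = γ * (gProfile b₁ b₂ γ (x * y) * z) := by
  have hγc : (γ : ℂ) ≠ 0 := by exact_mod_cast (by linarith : γ ≠ 0)
  rw [← gKernel_eq_gProfile hγ h₁ h₂ hx hy]
  field_simp

theorem setIntegral_gKernel_eq (hγ : 1 ≤ γ) (h₁ : (1 - γ) / 2 ≤ b₁) (h₂ : (1 - γ) / 2 ≤ b₂)
    {s : Set ℝ} (hs : MeasurableSet s) (hs0 : s ⊆ Ioi 0) (f : ℝ → ℂ) {x : ℝ} (hx : 0 < x) :
    1 / (γ : ℂ) * ∫ y in s, gKernel b₁ b₂ γ x y * f y =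
      ∫ y in s, gProfile b₁ b₂ γ (x * y) * f y := by
  rw [← integral_const_mul]
  refine setIntegral_congr_fun hs fun y hy => ?_
  rw [← mul_assoc, gKernel_eq_gProfile hγ h₁ h₂ hx (hs0 hy)]

theorem gTransformTrunc_eq (hγ : 1 ≤ γ) (h₁ : (1 - γ) / 2 ≤ b₁) (h₂ : (1 - γ) / 2 ≤ b₂)
    (R : ℝ) (f : L2Pos) {x : ℝ} (hx : 0 < x) :
    gTransformTrunc b₁ b₂ γ R f x = kernelOp (gProfile b₁ b₂ γ) (truncL2 R f) x := by
  rw [kernelOp_congr_ae (coeFn_truncL2 R f), kernelOp_indicator, gTransformTrunc,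
    setIntegral_gKernel_eq hγ h₁ h₂ measurableSet_Ioc Ioc_subset_Ioi_self _ hx]

/-- The truncated integral is the operator applied to the truncation of `f`, so its `L²` convergence
follows from that of the truncations, by isometry. -/
theorem isGTransform_unitaryOp (hγ : 1 ≤ γ) (h₁ : (1 - γ) / 2 ≤ b₁) (h₂ : (1 - γ) / 2 ≤ b₂)
    {C a : ℝ} (hκ : IsIsometricKernel (gProfile b₁ b₂ γ) C a) (f : L2Pos) :
    IsGTransform b₁ b₂ γ f (hκ.unitaryOp f) := by
  have hw : ∀ R, WeightedIntegrable a (truncL2 R f) := fun R =>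
    (weightedIntegrable_indicator_Ioc hκ.lt_exponent (Lp.memLp f) R).congr_ae
      (coeFn_truncL2 R f).symm
  have hS : ∀ R, hκ.unitaryOp (truncL2 R f) =ᵐ[volume.restrict (Ioi 0)]
      gTransformTrunc b₁ b₂ γ R f := by
    intro R
    filter_upwards [hκ.coeFn_unitaryOp (hw R), ae_restrict_mem measurableSet_Ioi] with x hx hx0
    rw [hx, gTransformTrunc_eq hγ h₁ h₂ R f hx0]
  have hmem : ∀ R, MemLp (gTransformTrunc b₁ b₂ γ R f) 2 (volume.restrict (Ioi (0 : ℝ))) :=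
    fun R => (memLp_congr_ae (hS R)).1 (Lp.memLp _)
  have hlim : Tendsto (fun R : ℝ => eLpNorm (gTransformTrunc b₁ b₂ γ R f -
      (hκ.unitaryOp f : ℝ → ℂ)) 2 (volume.restrict (Ioi (0 : ℝ)))) atTop (𝓝 0) := by
    refine (tendsto_eLpNorm_indicator_Ioc_sub (Lp.memLp f)).congr fun R => ?_
    rw [← eLpNorm_congr_ae ((coeFn_truncL2 R f).sub (EventuallyEq.refl _ f)),
      ← eLpNorm_congr_ae ((hS R).sub (EventuallyEq.refl _ (hκ.unitaryOp f))),
      ← eLpNorm_congr_ae (Lp.coeFn_sub _ _), ← eLpNorm_congr_ae (Lp.coeFn_sub _ _), ← map_sub]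
    have h := hκ.unitaryOp.norm_map (truncL2 R f - f)
    rw [Lp.norm_def, Lp.norm_def, ENNReal.toReal_eq_toReal_iff' (Lp.eLpNorm_ne_top _)
      (Lp.eLpNorm_ne_top _)] at h
    exact h.symm
  refine ⟨fun R _ x hx => ?_, fun R _ => hmem R, hlim, ?_⟩
  · have h := ((hκ.integrable (weightedIntegrable_indicator_Ioc hκ.lt_exponent (Lp.memLp f) R)
      hx).mono_set (t := Ioi 0) (s := Ioc 0 R) Ioc_subset_Ioi_self).const_mul (γ : ℂ)
    refine IntegrableOn.congr_fun h (fun y hy => ?_) measurableSet_Ioc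
    rw [indicator_of_mem hy, gKernel_mul_eq hγ h₁ h₂ hx hy.1]
  · have hlimn := hlim.comp (tendsto_natCast_atTop_atTop (R := ℝ))
    have hmeas := tendstoInMeasure_of_tendsto_eLpNorm two_ne_zero
      (fun n : ℕ => (hmem n).1) (Lp.memLp (hκ.unitaryOp f)).1 hlimn
    obtain ⟨ns, hns, hae⟩ := hmeas.exists_seq_tendsto_ae
    filter_upwards [hae, ae_restrict_mem measurableSet_Ioi] with x hx hx0 hint
    refine tendsto_nhds_unique hx ?_
    have hb : Tendsto (fun i => (ns i : ℝ)) atTop atTop :=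
      tendsto_natCast_atTop_atTop.comp hns.tendsto_atTop
    refine ((intervalIntegral_tendsto_integral_Ioi 0 hint hb).const_mul (1 / (γ : ℂ))).congr
      fun i => ?_
    rw [gTransformTrunc, intervalIntegral.integral_of_le (Nat.cast_nonneg _)]

theorem IsGTransform.unique {f g g' : L2Pos} (h : IsGTransform b₁ b₂ γ f g)
    (h' : IsGTransform b₁ b₂ γ f g') : g = g' := by
  have hle : ∀ R > 0, eLpNorm ((g : ℝ → ℂ) - (g' : ℝ → ℂ)) 2 (volume.restrict (Ioi (0 : ℝ))) ≤
      eLpNorm (gTransformTrunc b₁ b₂ γ R f - (g : ℝ → ℂ)) 2 (volume.restrict (Ioi (0 : ℝ))) +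
      eLpNorm (gTransformTrunc b₁ b₂ γ R f - (g' : ℝ → ℂ)) 2 (volume.restrict (Ioi (0 : ℝ))) := by
    intro R hR
    have e : (g : ℝ → ℂ) - (g' : ℝ → ℂ) = (gTransformTrunc b₁ b₂ γ R f - (g' : ℝ → ℂ)) -
        (gTransformTrunc b₁ b₂ γ R f - (g : ℝ → ℂ)) := by ring
    rw [e, add_comm]
    exact eLpNorm_sub_le ((h.memLp R hR).1.sub (Lp.memLp g').1)
      ((h.memLp R hR).1.sub (Lp.memLp g).1) one_le_two
  have hlim := h.tendsto.add h'.tendsto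
  rw [add_zero] at hlim
  have h0 : eLpNorm ((g : ℝ → ℂ) - (g' : ℝ → ℂ)) 2 (volume.restrict (Ioi (0 : ℝ))) = 0 :=
    le_antisymm (ge_of_tendsto hlim ((eventually_gt_atTop 0).mono hle)) zero_le
  rw [eLpNorm_eq_zero_iff ((Lp.memLp g).1.sub (Lp.memLp g').1) two_ne_zero] at h0
  exact Lp.ext (h0.mono fun x hx => sub_eq_zero.1 hx)

end

end

theorem mainTheorem5 (b₁ b₂ γ : ℝ)
    (hb₁ : ∃ m : ℤ, b₁ = m / 2) (hb₂ : ∃ m : ℤ, b₂ = m / 2) (hγ : ∃ m : ℤ, γ = m / 2)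
    (hb₁_nonneg : 0 ≤ b₁) (hγ_one : 1 ≤ γ)
    (hb₂_lower : (1 - γ) / 2 ≤ b₂) (hb₂_upper : b₂ ≤ 1 / 2 + b₁) :
    (∃! S : L2Pos ≃ₗᵢ[ℂ] L2Pos, ∀ f : L2Pos, IsGTransform b₁ b₂ γ f (S f)) ∧
    ∀ S : L2Pos ≃ₗᵢ[ℂ] L2Pos, (∀ f : L2Pos, IsGTransform b₁ b₂ γ f (S f)) →
      orderOf S = 2 ∧ S⁻¹ = S ∧
      ∀ f : L2Pos, IsGTransform b₁ b₂ γ f (S f) ∧ IsGTransform b₁ b₂ γ (S f) f := by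
  -- `γ ≥ 1` makes the left side nonpositive; from here on `b₁` and `b₂` play symmetric roles.
  have h₁ : (1 - γ) / 2 ≤ b₁ := by linarith
  obtain ⟨C, a, hκ⟩ := exists_isIsometricKernel_gProfile hγ_one h₁ hb₂_lower
  have hex := isGTransform_unitaryOp hγ_one h₁ hb₂_lower hκ
  have huniq : ∀ S : L2Pos ≃ₗᵢ[ℂ] L2Pos, (∀ f : L2Pos, IsGTransform b₁ b₂ γ f (S f)) →
      S = hκ.unitaryOp := fun S hS => LinearIsometryEquiv.ext fun f => (hS f).unique (hex f)
  refine ⟨⟨hκ.unitaryOp, hex, huniq⟩, fun S hS => ?_⟩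
  obtain rfl := huniq S hS
  have hsq : hκ.unitaryOp * hκ.unitaryOp = 1 :=
    LinearIsometryEquiv.ext fun f => hκ.unitaryOp_unitaryOp f
  refine ⟨orderOf_eq_prime (by rw [sq, hsq]) hκ.unitaryOp_ne_one,
    inv_eq_of_mul_eq_one_left hsq, fun f => ⟨hS f, ?_⟩⟩
  have h := hex (hκ.unitaryOp f)
  rwa [hκ.unitaryOp_unitaryOp] at h
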